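/- **Definitions.** Let $M$ be a monoid. An *atom* of $M$ is an element $a\neq 1$ such that $a=bc$ implies $b=1$ or $c=1$; $\|a\|$ denotes the supremum of the lengths of all expressions of $a$ as a product of atoms. $M$ is *atomic* if it is generated by its atoms and $\|a\|<\infty$ for all $a\in M$. Write $a\le_L b$ if $ac=b$ for some $c\in M$, and $a\le_R b$ if $ca=b$ for some $c\in M$. An atomic monoid $M$ is a *Garside monoid* with *Garside element* $\Delta\in M$ if it is finitely generated and left and right cancellative, $(M,\le_L)$ and $(M,\le_R)$ are lattices, $a\le_L\Delta\iff a\le_R\Delta$ for all $a\in M$, and the set $\mathcal D=\{a\in M: a\le_L\Delta\}$ of *simple elements* generates $M$. (The set $\mathcal D$ is then finite.) A *Garside group* $G$ is the group of fractions of a Garside monoid $M=G^+\subseteq G$. For $g,h\in G$ write $g\le_L h$ if $gc=h$ for some $c\in G^+$; let $\inf(g)=\max\{r\in\mathbb Z:\Delta^r\le_L g\}$ and $\sup(g)=\min\{s\in\mathbb Z: g\le_L\Delta^s\}$ (both read as $0$ when $\Delta=1$, in which case $G$ is trivial). Let $[g]$ be the conjugacy class of $g$, and let $\inf_s(g)=\max\{\inf(h):h\in[g]\}$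 and $\sup_s(g)=\min\{\sup(h):h\in[g]\}$. The *super summit set* and the *stable super summit set* of $g$ are $$[g]^S=\{h\in[g]:\inf(h)=\inf{}_s(g),\ \sup(h)=\sup{}_s(g)\},\qquad [g]^{\mathrm{St}}=\{h\in[g]^S: h^n\in[g^n]^S\text{ for all }n\ge 1\}.$$ **Statement.** (1) There is a single algorithm (a partial recursive function) with the following property. Its input consists of a description of a Garside group $G$ with Garside element $\Delta$ by its simple elements, that is, for some enumeration $\mathcal D=\{s_1,\dots,s_k\}$ without repetition, the number $k$, the index of $\Delta$ and the list of all triples $(i,j,l)$ with $s_is_j=s_l$; together with two words in the letters $s_1^{\pm1},\dots,s_k^{\pm1}$, representing elements $g,h\in G$. On every such input it halts after finitely many steps and decides correctly whether $h\in[g]^{\mathrm{St}}$ or not. (2) Let $G$ be a Garside group with Garside element $\Delta$, and let $N=\|\Delta\|$. For all $g,h\in G$, one has $h\in[g]^{\mathrm{St}}$ if and only if $h^n\in[g^n]^S$ for all $n$ with $1\le n\le N$. -/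

import Mathlib

universe u

namespace Garside

/-! ### Garside monoids -/

section Monoid

variable {M : Type*} [Monoid M]

/-- An atom of a monoid: an element `a ≠ 1` such that `a = bc` implies `b = 1` or `c = 1`. -/
def IsMulAtom (a : M) : Prop :=
  a ≠ 1 ∧ ∀ b c : M, a = b * c → b = 1 ∨ c = 1

/-- The lists of atoms whose product is `a`. -/
def atomExpressions (a : M) : Set (List M) :=
  {l | (∀ x ∈ l, IsMulAtom x) ∧ l.prod = a}

/-- `‖a‖`: the supremum, possibly infinite, of the lengths of all expressions of `a` in terms
of atoms. -/
noncomputable def atomNorm (a : M) : ℕ∞ :=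
  ⨆ l ∈ atomExpressions a, (l.length : ℕ∞)

/-- `a ≤_L b` in a monoid. -/
def LeL (a b : M) : Prop := ∃ c : M, a * c = b

/-- `a ≤_R b` in a monoid. -/
def LeR (a b : M) : Prop := ∃ c : M, c * a = b

/-- The relation `r` is a partial order in which any two elements have a greatest lower bound
and a least upper bound. -/
structure IsLatticeOrder {α : Type*} (r : α → α → Prop) : Prop where
  refl : ∀ a, r a a
  trans : ∀ a b c, r a b → r b c → r a c
  antisymm : ∀ a b, r a b → r b a → a = b
  exists_meet : ∀ a b, ∃ d, r d a ∧ r d b ∧ ∀ x, r x a → r x b → r x d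
  exists_join : ∀ a b, ∃ d, r a d ∧ r b d ∧ ∀ x, r a x → r b x → r d x

variable (M) in
/-- A monoid is atomic if its atoms generate it and `‖a‖ < ∞` for all `a`. -/
structure IsAtomicMonoid : Prop where
  closure_atoms : Submonoid.closure {a : M | IsMulAtom a} = ⊤
  atomNorm_lt_top : ∀ a : M, atomNorm a < ⊤

/-- The monoid `M` is a Garside monoid with Garside element `Δ`. -/
structure IsGarsideMonoid (Δ : M) : Prop where
  atomic : IsAtomicMonoid M
  finitely_generated : Monoid.FG M
  mul_left_cancel : ∀ a b c : M, a * b = a * c → b = c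
  mul_right_cancel : ∀ a b c : M, b * a = c * a → b = c
  lattice_left : IsLatticeOrder (LeL (M := M))
  lattice_right : IsLatticeOrder (LeR (M := M))
  leL_iff_leR : ∀ a : M, LeL a Δ ↔ LeR a Δ
  closure_simples : Submonoid.closure {a : M | LeL a Δ} = ⊤

end Monoid

/-! ### Garside groups -/

section Group

variable {G : Type*} [Group G]

/-- `G` is a Garside group with positive monoid `P` and Garside element `Δ`: the submonoid `P`
is a Garside monoid with Garside element `Δ`, and `G` is its group of fractions. -/
structure IsGarsideGroup (P : Submonoid G) (Δ : P) : Prop where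
  garsideMonoid : IsGarsideMonoid Δ
  exists_fraction : ∀ g : G, ∃ a ∈ P, ∃ b ∈ P, g = a * b⁻¹

/-- `g ≤_L h` in a Garside group with positive monoid `P`. -/
def GroupLeL (P : Submonoid G) (g h : G) : Prop := ∃ c ∈ P, g * c = h

/-- The set of simple elements, as a subset of the group. -/
def simples (P : Submonoid G) (Δ : P) : Set G := {g | ∃ a : P, LeL a Δ ∧ (a : G) = g}

/-- `inf(g) = max {r ∈ ℤ : Δ^r ≤_L g}`. -/
noncomputable def infG (P : Submonoid G) (Δ : P) (g : G) : ℤ :=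
  sSup {r : ℤ | GroupLeL P ((Δ : G) ^ r) g}

/-- `sup(g) = min {s ∈ ℤ : g ≤_L Δ^s}`. -/
noncomputable def supG (P : Submonoid G) (Δ : P) (g : G) : ℤ :=
  sInf {r : ℤ | GroupLeL P g ((Δ : G) ^ r)}

/-- `inf_s(g)`, the maximum of `inf` on the conjugacy class of `g`. -/
noncomputable def infS (P : Submonoid G) (Δ : P) (g : G) : ℤ :=
  sSup (infG P Δ '' conjugatesOf g)

/-- `sup_s(g)`, the minimum of `sup` on the conjugacy class of `g`. -/
noncomputable def supS (P : Submonoid G) (Δ : P) (g : G) : ℤ :=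
  sInf (supG P Δ '' conjugatesOf g)

/-- The super summit set `[g]^S`. -/
def superSummitSet (P : Submonoid G) (Δ : P) (g : G) : Set G :=
  {h ∈ conjugatesOf g | infG P Δ h = infS P Δ g ∧ supG P Δ h = supS P Δ g}

/-- The stable super summit set `[g]^St`. -/
def stableSuperSummitSet (P : Submonoid G) (Δ : P) (g : G) : Set G :=
  {h ∈ superSummitSet P Δ g | ∀ n : ℕ, 1 ≤ n → h ^ n ∈ superSummitSet P Δ (g ^ n)}

end Group

/-! ### Inputs of the algorithm -/

/-- What the algorithm is told about the Garside group: the number of simple elements, the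
index of the Garside element, and a list of triples of indices (the multiplication table). -/
abbrev GroupCode : Type := ℕ × ℕ × List (ℕ × ℕ × ℕ)

/-- What the algorithm is told about an element: a word whose letters are indices of simple
elements, each with a sign (`true` for the simple element, `false` for its inverse). -/
abbrev WordCode : Type := List (ℕ × Bool)

section Coding

variable {G : Type*} [Group G]

/-- `s` lists the simple elements without repetition, and `(k, d, T)` records their number, the
index of `Δ`, and all the products of two simple elements that are simple again. -/
structure IsCode (P : Submonoid G) (Δ : P) {k : ℕ} (s : Fin k → G) (c : GroupCode) : Prop where
  injective : Function.Injective s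
  range_eq : Set.range s = simples P Δ
  card_eq : c.1 = k
  delta_eq : ∃ d : Fin k, c.2.1 = d ∧ s d = Δ
  mem_table_iff : ∀ i j l : ℕ, (i, j, l) ∈ c.2.2 ↔
    ∃ a b e : Fin k, i = a ∧ j = b ∧ l = e ∧ s a * s b = s e

/-- The element of the group represented by a signed word in the simple elements. -/
def wordValue {k : ℕ} (s : Fin k → G) (w : List (Fin k × Bool)) : G :=
  (w.map fun x => if x.2 then s x.1 else (s x.1)⁻¹).prod

/-- A signed word in the simple elements, as the algorithm reads it. -/
def wordCode {k : ℕ} (w : List (Fin k × Bool)) : WordCode :=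
  w.map fun x => ((x.1 : ℕ), x.2)

/-- A Garside group has finitely many simple elements, so it has a code. -/
theorem IsGarsideGroup.exists_isCode {P : Submonoid G} {Δ : P} (hG : IsGarsideGroup P Δ) :
    ∃ (k : ℕ) (s : Fin k → G) (c : GroupCode), IsCode P Δ s c := by
  classical
  have hM := hG.garsideMonoid
  -- every atom lies in every generating set
  have hat : {a : P | IsMulAtom a}.Finite := by
    obtain ⟨S, hS⟩ := hM.finitely_generated
    refine S.finite_toSet.subset ?_
    intro a ha
    have hmem : a ∈ Submonoid.closure (S : Set P) := by rw [hS]; trivial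
    have key : ∀ x ∈ Submonoid.closure (S : Set P), x = 1 ∨ ¬ IsMulAtom x ∨ x ∈ S := by
      intro x hx
      induction hx using Submonoid.closure_induction with
      | mem x hx => exact Or.inr (Or.inr hx)
      | one => exact Or.inl rfl
      | mul x y _ _ ihx ihy =>
        by_cases h : IsMulAtom (x * y)
        · rcases h.2 x y rfl with h1 | h1
          · simpa [h1] using ihy
          · simpa [h1] using ihx
        · exact Or.inr (Or.inl h)
    rcases key a hmem with h | h | h
    · exact absurd h ha.1
    · exact absurd ha h
    · exact h
  have hlist : ∀ x : P, ∃ l : List P, (∀ y ∈ l, IsMulAtom y) ∧ l.prod = x := by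
    intro x
    have hx : x ∈ Submonoid.closure {a : P | IsMulAtom a} := by
      rw [hM.atomic.closure_atoms]; trivial
    exact Submonoid.exists_list_of_mem_closure hx
  have hfin : (simples P Δ).Finite := by
    obtain ⟨N, hN⟩ := ENat.ne_top_iff_exists.1 (hM.atomic.atomNorm_lt_top Δ).ne
    have h1 : {l : List P | (∀ y ∈ l, y ∈ {a : P | IsMulAtom a}) ∧ l.length ≤ N}.Finite := by
      have := hat.to_subtype
      refine ((List.finite_length_le {a : P | IsMulAtom a} N).image
        (List.map Subtype.val)).subset ?_
      rintro l ⟨hl, hlen⟩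
      refine ⟨l.attach.map fun y => ⟨y.1, hl y.1 y.2⟩, ?_, ?_⟩
      · change (List.map _ _).length ≤ N
        rw [List.length_map, List.length_attach]
        exact hlen
      · rw [List.map_map]
        exact l.attach_map_subtype_val
    refine (h1.image fun l => (l.prod : G)).subset ?_
    rintro g ⟨a, ⟨c, hc⟩, rfl⟩
    obtain ⟨l, hl, rfl⟩ := hlist a
    obtain ⟨l', hl', rfl⟩ := hlist c
    refine ⟨l, ⟨hl, ?_⟩, rfl⟩
    have h2 : ((l ++ l').length : ℕ∞) ≤ atomNorm Δ := by
      refine le_iSup₂_of_le (l ++ l') ⟨?_, by simpa using hc⟩ le_rfl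
      intro x hx
      rcases List.mem_append.1 hx with h | h
      · exact hl x h
      · exact hl' x h
    rw [← hN] at h2
    have h3 := Nat.cast_le.1 h2
    rw [List.length_append] at h3
    omega
  have := hfin.to_subtype
  obtain ⟨k, ⟨e⟩⟩ := Finite.exists_equiv_fin (simples P Δ)
  obtain ⟨d, hd⟩ : ∃ d : Fin k, ((e.symm d : simples P Δ) : G) = Δ :=
    ⟨e ⟨Δ, Δ, ⟨1, mul_one _⟩, rfl⟩, by simp⟩
  let s : Fin k → G := fun i => (e.symm i : G)
  let T : List (Fin k × Fin k × Fin k) :=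
    (Finset.univ.filter fun t : Fin k × Fin k × Fin k => s t.1 * s t.2.1 = s t.2.2).toList
  refine ⟨k, s, (k, d, T.map fun t => ((t.1 : ℕ), (t.2.1 : ℕ), (t.2.2 : ℕ))),
    ⟨?_, ?_, rfl, ⟨d, rfl, hd⟩, ?_⟩⟩
  · exact Subtype.val_injective.comp e.symm.injective
  · change Set.range (Subtype.val ∘ e.symm) = _
    rw [Set.range_comp, e.symm.surjective.range_eq]
    simp
  · intro i j l
    simp only [T, List.mem_map, Finset.mem_toList, Finset.mem_filter, Finset.mem_univ, true_and,
      Prod.mk.injEq, Prod.exists]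
    constructor
    · rintro ⟨a, b, e, h, rfl, rfl, rfl⟩
      exact ⟨a, b, e, rfl, rfl, rfl, h⟩
    · rintro ⟨a, b, e, rfl, rfl, rfl, h⟩
      exact ⟨a, b, e, h, rfl, rfl, rfl⟩

/-- Every element of a Garside group is represented by a signed word in the simple elements. -/
theorem IsCode.exists_wordValue_eq {P : Submonoid G} {Δ : P} (hG : IsGarsideGroup P Δ) {k : ℕ}
    {s : Fin k → G} {c : GroupCode} (hc : IsCode P Δ s c) (g : G) :
    ∃ w : List (Fin k × Bool), wordValue s w = g := by
  have happ : ∀ v w : List (Fin k × Bool), wordValue s (v ++ w) = wordValue s v * wordValue s w :=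
    fun v w => by simp [wordValue]
  have hpos : ∀ a : P, ∃ w w' : List (Fin k × Bool),
      wordValue s w = a ∧ wordValue s w' = (a : G)⁻¹ := by
    intro a
    have ha : a ∈ Submonoid.closure {a : P | LeL a Δ} := by
      rw [hG.garsideMonoid.closure_simples]; trivial
    induction ha using Submonoid.closure_induction with
    | mem x hx =>
      obtain ⟨i, hi⟩ : (x : G) ∈ Set.range s := by rw [hc.range_eq]; exact ⟨x, hx, rfl⟩
      exact ⟨[(i, true)], [(i, false)], by simp [wordValue, hi], by simp [wordValue, hi]⟩
    | one => exact ⟨[], [], by simp [wordValue], by simp [wordValue]⟩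
    | mul x y _ _ ihx ihy =>
      obtain ⟨v, v', hv, hv'⟩ := ihx
      obtain ⟨w, w', hw, hw'⟩ := ihy
      exact ⟨v ++ w, w' ++ v', by simp [happ, hv, hw], by simp [happ, hv', hw']⟩
  obtain ⟨a, ha, b, hb, rfl⟩ := hG.exists_fraction g
  obtain ⟨v, -, hv, -⟩ := hpos ⟨a, ha⟩
  obtain ⟨-, w, -, hw⟩ := hpos ⟨b, hb⟩
  exact ⟨v ++ w, by rw [happ, hv, hw]⟩

end Coding

end Garside

/-! Since `sup(g) = -inf(g⁻¹)`, membership in a super summit set means conjugacy together with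
maximality of `inf` within the conjugacy class (`InfMax`), both for the element and for its inverse.
So part (2) reduces to the claim that if `inf(hⁿ)` is maximal for all `n ≤ N = ‖Δ‖`, then it is
maximal for all `n ≥ 1`.

Suppose that some conjugate of `hᵐ` is at least `Δ^p`. After replacing `h` by that conjugate, give
`hⁿΔᵏ` the weight `np + km`, and let `B j` be the meet of all such elements of weight at least `j`.
Then `B` is increasing, `B (j + m) = B j * Δ`, and `h * B j ≥ B (j + p)` (`exists_filtration`). If
`m > N`, the chain `B 0 ≤ ... ≤ B m = B 0 * Δ` has more steps than `‖Δ‖` allows, so `B j = B (j +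
1)` for some `j`. If moreover `np + 1 = zm`, then `hⁿ * B j ≥ B (j + 1 + np) = B j * Δ^z`, so
conjugation by `B j` raises `hⁿ` to at least `Δ^z`, with `z/n > p/m` (`exists_smaller_of_coprime`).
For `p` and `m` coprime such an `n < m` exists; otherwise the fraction is reduced. Descent on `m`
shows that every ratio `p/m` is matched or exceeded by one whose denominator is at most `N`
(`exists_le_natNorm`). Maximality then passes to `hⁿ` by splitting off a factor `h^q` with `q ≤ N`.

For part (1), `N` is smaller than the number `k` of simple elements, so finitely many powers have to
be tested. Words are compared by a positivity test that uses only least common multiples of simple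
elements. The conjugates with `inf ≥ -m` and `sup ≤ m` are finite in number and are connected by
conjugations by simple elements and their inverses (`conj_mem_of_closed`). A finite list closed
under these moves is therefore complete and serves as a checkable certificate. This range suffices
for computing the maximal `inf`, because `inf` can be raised without raising `sup`
(`exists_conj_between`). The algorithm searches through all certificates. -/

namespace Garside

/-! ### The left order on a Garside group, and its lattice structure. -/

section Order

variable {G : Type*} [Group G] {P : Submonoid G} {Δ : P}

theorem groupLeL_iff {g h : G} : GroupLeL P g h ↔ g⁻¹ * h ∈ P := by
  constructor
  · rintro ⟨c, hc, rfl⟩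
    simpa using hc
  · intro h1
    exact ⟨_, h1, by group⟩

theorem GroupLeL.refl (g : G) : GroupLeL P g g := ⟨1, P.one_mem, mul_one g⟩

theorem GroupLeL.trans {g h k : G} (h1 : GroupLeL P g h) (h2 : GroupLeL P h k) :
    GroupLeL P g k := by
  obtain ⟨c, hc, rfl⟩ := h1
  obtain ⟨d, hd, rfl⟩ := h2
  exact ⟨c * d, P.mul_mem hc hd, by group⟩

theorem groupLeL_mul_left_iff {a g h : G} : GroupLeL P (a * g) (a * h) ↔ GroupLeL P g h := by
  rw [groupLeL_iff, groupLeL_iff]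
  simp [mul_assoc]

theorem one_groupLeL_iff {g : G} : GroupLeL P 1 g ↔ g ∈ P := by
  rw [groupLeL_iff]
  simp

theorem leL_coe_iff {a b : P} : LeL a b ↔ GroupLeL P (a : G) b := by
  constructor
  · rintro ⟨c, rfl⟩
    exact ⟨c, c.2, rfl⟩
  · rintro ⟨c, hc, h⟩
    exact ⟨⟨c, hc⟩, Subtype.ext h⟩

/-- The norm of an element of an atomic monoid, as a natural number. -/
noncomputable def natNorm {M : Type*} [Monoid M] (a : M) : ℕ := (atomNorm a).toNat

namespace IsAtomicMonoid

variable {M : Type*} [Monoid M] (hM : IsAtomicMonoid M)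
include hM

theorem coe_natNorm (a : M) : (natNorm a : ℕ∞) = atomNorm a :=
  ENat.natCast_toNat (hM.atomNorm_lt_top a).ne

theorem exists_atomExpression (a : M) : ∃ l, l ∈ atomExpressions a := by
  have ha : a ∈ Submonoid.closure {a : M | IsMulAtom a} := by
    rw [hM.closure_atoms]; trivial
  obtain ⟨l, hl⟩ := Submonoid.exists_list_of_mem_closure ha
  exact ⟨l, hl⟩

theorem length_le_natNorm {a : M} {l : List M} (hl : l ∈ atomExpressions a) :
    l.length ≤ natNorm a := by
  have h : (l.length : ℕ∞) ≤ atomNorm a := le_iSup₂_of_le l hl le_rfl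
  rw [← hM.coe_natNorm] at h
  exact_mod_cast h

theorem exists_length_eq_natNorm (a : M) : ∃ l ∈ atomExpressions a, l.length = natNorm a := by
  by_contra! hne
  obtain ⟨l₀, hl₀⟩ := hM.exists_atomExpression a
  have hlt : ∀ l ∈ atomExpressions a, l.length < natNorm a := fun l hl =>
    lt_of_le_of_ne (hM.length_le_natNorm hl) (hne l hl)
  have h0 := hlt _ hl₀
  have : atomNorm a ≤ ((natNorm a - 1 : ℕ) : ℕ∞) := by
    refine iSup₂_le fun l hl => ?_
    have := hlt l hl
    exact_mod_cast (by omega : l.length ≤ natNorm a - 1)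
  rw [← hM.coe_natNorm] at this
  have h1 : natNorm a ≤ natNorm a - 1 := by exact_mod_cast this
  omega

theorem natNorm_add_le (a b : M) : natNorm a + natNorm b ≤ natNorm (a * b) := by
  obtain ⟨l, hl, h1⟩ := hM.exists_length_eq_natNorm a
  obtain ⟨l', hl', h2⟩ := hM.exists_length_eq_natNorm b
  rw [← h1, ← h2, ← List.length_append]
  refine hM.length_le_natNorm ⟨?_, by rw [List.prod_append, hl.2, hl'.2]⟩
  intro x hx
  rcases List.mem_append.1 hx with h | h
  · exact hl.1 x h
  · exact hl'.1 x h

theorem eq_one_of_natNorm_eq_zero {a : M} (h : natNorm a = 0) : a = 1 := by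
  obtain ⟨l, hl, h1⟩ := hM.exists_length_eq_natNorm a
  rw [h, List.length_eq_zero_iff] at h1
  subst h1
  exact hl.2.symm

end IsAtomicMonoid

namespace IsGarsideGroup

variable (hG : IsGarsideGroup P Δ)
include hG

theorem antisymm {g h : G} (h1 : GroupLeL P g h) (h2 : GroupLeL P h g) : g = h := by
  rw [groupLeL_iff] at h1 h2
  have h3 : g⁻¹ * h = 1 := by
    have := hG.garsideMonoid.lattice_left.antisymm 1 ⟨_, h1⟩ ⟨⟨_, h1⟩, by simp⟩
      ⟨⟨_, h2⟩, Subtype.ext (by simp [mul_assoc])⟩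
    exact (congrArg Subtype.val this).symm
  exact (inv_mul_eq_one.1 h3)

theorem mem_induction {p : G → Prop} (hs : ∀ a ∈ simples P Δ, p a) (h1 : p 1)
    (hm : ∀ a b, p a → p b → p (a * b)) {a : G} (ha : a ∈ P) : p a := by
  have h : (⟨a, ha⟩ : P) ∈ Submonoid.closure {a : P | LeL a Δ} := by
    rw [hG.garsideMonoid.closure_simples]; trivial
  suffices H : ∀ x ∈ Submonoid.closure {a : P | LeL a Δ}, p (x : G) from H _ h
  intro x hx
  induction hx using Submonoid.closure_induction with
  | mem x hx => exact hs _ ⟨x, hx, rfl⟩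
  | one => exact h1
  | mul x y _ _ ihx ihy => exact hm _ _ ihx ihy

omit hG in
theorem mem_simples_iff {a : G} : a ∈ simples P Δ ↔ a ∈ P ∧ GroupLeL P a Δ := by
  constructor
  · rintro ⟨a, ha, rfl⟩
    exact ⟨a.2, leL_coe_iff.1 ha⟩
  · rintro ⟨h1, h2⟩
    exact ⟨⟨a, h1⟩, leL_coe_iff.2 h2, rfl⟩

theorem mem_simples_iff_right {a : G} : a ∈ simples P Δ ↔ a ∈ P ∧ (Δ : G) * a⁻¹ ∈ P := by
  constructor
  · rintro ⟨a, ha, rfl⟩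
    obtain ⟨c, hc⟩ := (hG.garsideMonoid.leL_iff_leR a).1 ha
    refine ⟨a.2, ?_⟩
    rw [← hc]
    simp
  · rintro ⟨h1, h2⟩
    refine ⟨⟨a, h1⟩, (hG.garsideMonoid.leL_iff_leR _).2 ⟨⟨_, h2⟩, Subtype.ext (by simp)⟩, rfl⟩

theorem inv_mul_mem_simples {a : G} (ha : a ∈ simples P Δ) : a⁻¹ * Δ ∈ simples P Δ := by
  obtain ⟨h1, h2⟩ := mem_simples_iff.1 ha
  rw [hG.mem_simples_iff_right]
  exact ⟨groupLeL_iff.1 h2, by simpa using h1⟩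

theorem mul_inv_mem_simples {a : G} (ha : a ∈ simples P Δ) : (Δ : G) * a⁻¹ ∈ simples P Δ := by
  obtain ⟨h1, h2⟩ := hG.mem_simples_iff_right.1 ha
  rw [mem_simples_iff, groupLeL_iff]
  exact ⟨h2, by simpa using h1⟩

/-- For simple `a`, taking the right complement `a ↦ a⁻¹Δ` twice gives `Δ⁻¹aΔ`, which is therefore
simple. Products extend this to all positive elements. -/
theorem inv_delta_conj_mem {a : G} (ha : a ∈ P) : (Δ : G)⁻¹ * a * Δ ∈ P := by
  refine hG.mem_induction (p := fun a => (Δ : G)⁻¹ * a * Δ ∈ P) (fun a ha => ?_) (by simp)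
    (fun a b h1 h2 => ?_) ha
  · have := (mem_simples_iff.1 (hG.inv_mul_mem_simples (hG.inv_mul_mem_simples ha))).1
    simpa [mul_assoc] using this
  · have := P.mul_mem h1 h2
    simpa [mul_assoc] using this

theorem delta_conj_mem {a : G} (ha : a ∈ P) : (Δ : G) * a * (Δ : G)⁻¹ ∈ P := by
  refine hG.mem_induction (p := fun a => (Δ : G) * a * (Δ : G)⁻¹ ∈ P) (fun a ha => ?_) (by simp)
    (fun a b h1 h2 => ?_) ha
  · have := (mem_simples_iff.1 (hG.mul_inv_mem_simples (hG.mul_inv_mem_simples ha))).1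
    simpa [mul_assoc] using this
  · have := P.mul_mem h1 h2
    simpa [mul_assoc] using this

theorem zpow_conj_mem (z : ℤ) {a : G} (ha : a ∈ P) : (Δ : G) ^ z * a * ((Δ : G) ^ z)⁻¹ ∈ P := by
  induction z with
  | zero => simpa using ha
  | succ n ih =>
    have := hG.delta_conj_mem ih
    rw [add_comm, zpow_add, zpow_one]
    simpa [mul_assoc] using this
  | pred n ih =>
    have := hG.inv_delta_conj_mem ih
    rw [sub_eq_add_neg, add_comm, zpow_add, zpow_neg_one]
    simpa [mul_assoc] using this

/-- The order is invariant under all left translations, but right translation preserves it here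
because conjugation by powers of `Δ` maps `P` to itself. -/
theorem mul_zpow_le_iff {g h : G} (z : ℤ) :
    GroupLeL P (g * (Δ : G) ^ z) (h * (Δ : G) ^ z) ↔ GroupLeL P g h := by
  have key : ∀ (g h : G) (z : ℤ), GroupLeL P g h →
      GroupLeL P (g * (Δ : G) ^ z) (h * (Δ : G) ^ z) := by
    intro g h z hgh
    rw [groupLeL_iff] at *
    have := hG.zpow_conj_mem (-z) hgh
    simpa [mul_assoc] using this
  refine ⟨fun H => ?_, key g h z⟩
  have := key _ _ (-z) H
  simpa using this

theorem shift_le_iff {g h : G} (x : G) (z : ℤ) :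
    GroupLeL P (x * g * (Δ : G) ^ z) (x * h * (Δ : G) ^ z) ↔ GroupLeL P g h := by
  rw [hG.mul_zpow_le_iff, groupLeL_mul_left_iff]

omit hG in
theorem zpow_le_zpow {a b : ℤ} (h : a ≤ b) : GroupLeL P ((Δ : G) ^ a) ((Δ : G) ^ b) := by
  rw [groupLeL_iff, ← zpow_neg, ← zpow_add]
  obtain ⟨n, hn⟩ := Int.eq_ofNat_of_zero_le (sub_nonneg.2 h)
  rw [show -a + b = n by omega, zpow_natCast]
  exact P.pow_mem Δ.2 n

theorem zpow_le_zpow_iff (hΔ : (Δ : G) ≠ 1) {a b : ℤ} :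
    GroupLeL P ((Δ : G) ^ a) ((Δ : G) ^ b) ↔ a ≤ b := by
  refine ⟨fun h => ?_, zpow_le_zpow⟩
  by_contra! hlt
  have h1 : GroupLeL P ((Δ : G) ^ (b + 1)) ((Δ : G) ^ b) := (zpow_le_zpow hlt).trans h
  have h2 := hG.antisymm h1 (zpow_le_zpow (by omega))
  rw [zpow_add, zpow_one] at h2
  exact hΔ (by simpa using h2)

/-- `g^n ≥ Δ^(nr)` if `g ≥ Δ^r`. -/
theorem zpow_le_pow {g : G} {r : ℤ} (h : GroupLeL P ((Δ : G) ^ r) g) (n : ℕ) :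
    GroupLeL P ((Δ : G) ^ (n * r)) (g ^ n) := by
  induction n with
  | zero => simpa using GroupLeL.refl _
  | succ n ih =>
    have h1 : GroupLeL P ((Δ : G) ^ (n * r) * (Δ : G) ^ r) (g ^ n * (Δ : G) ^ r) :=
      (hG.mul_zpow_le_iff r).2 ih
    rw [pow_succ, show ((n + 1 : ℕ) : ℤ) * r = n * r + r by push_cast; ring, zpow_add]
    exact h1.trans (groupLeL_mul_left_iff.2 h)

theorem zpow_add_le_mul {g h : G} {r s : ℤ} (h1 : GroupLeL P ((Δ : G) ^ r) g)
    (h2 : GroupLeL P ((Δ : G) ^ s) h) : GroupLeL P ((Δ : G) ^ (r + s)) (g * h) := by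
  rw [zpow_add]
  exact ((hG.mul_zpow_le_iff s).2 h1).trans (groupLeL_mul_left_iff.2 h2)

theorem le_zpow_iff_inv {g : G} {r : ℤ} :
    GroupLeL P g ((Δ : G) ^ r) ↔ GroupLeL P ((Δ : G) ^ (-r)) g⁻¹ := by
  rw [← hG.mul_zpow_le_iff (-r), ← groupLeL_mul_left_iff (a := g⁻¹)]
  simp

theorem exists_bounds (g : G) :
    ∃ n : ℕ, GroupLeL P ((Δ : G) ^ (-n : ℤ)) g ∧ GroupLeL P g ((Δ : G) ^ (n : ℤ)) := by
  have hP : ∀ a ∈ P, ∃ n : ℕ, GroupLeL P a ((Δ : G) ^ (n : ℤ)) := by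
    intro a ha
    refine hG.mem_induction (p := fun a => ∃ n : ℕ, GroupLeL P a ((Δ : G) ^ (n : ℤ)))
      (fun a ha => ⟨1, by simpa using (mem_simples_iff.1 ha).2⟩) ⟨0, by simpa using GroupLeL.refl _⟩
      ?_ ha
    rintro a b ⟨n, hn⟩ ⟨m, hm⟩
    refine ⟨n + m, ?_⟩
    push_cast
    rw [zpow_add]
    exact (groupLeL_mul_left_iff.2 hm).trans ((hG.mul_zpow_le_iff m).2 hn)
  have hlow : ∀ g : G, ∃ n : ℕ, GroupLeL P ((Δ : G) ^ (-n : ℤ)) g := by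
    intro g
    obtain ⟨a, ha, b, hb, rfl⟩ := hG.exists_fraction g
    obtain ⟨n, hn⟩ := hP b hb
    refine ⟨n, ?_⟩
    have h1 := hG.zpow_add_le_mul (r := 0) (by simpa using one_groupLeL_iff.2 ha)
      (hG.le_zpow_iff_inv.1 hn)
    simpa using h1
  obtain ⟨n, hn⟩ := hlow g
  obtain ⟨m, hm⟩ := hlow g⁻¹
  refine ⟨max n m, (zpow_le_zpow (by omega)).trans hn, ?_⟩
  rw [hG.le_zpow_iff_inv]
  exact (zpow_le_zpow (by omega)).trans hm

/-- Both elements lie above a common power of `Δ`. Left translation by its inverse makes them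
positive, and joins exist in the monoid. -/
theorem exists_join (x y : G) : ∃ d, GroupLeL P x d ∧ GroupLeL P y d ∧
    ∀ z, GroupLeL P x z → GroupLeL P y z → GroupLeL P d z := by
  obtain ⟨n, hn, -⟩ := hG.exists_bounds x
  obtain ⟨m, hm, -⟩ := hG.exists_bounds y
  set e : G := (Δ : G) ^ (-(max n m : ℕ) : ℤ)
  have hx : GroupLeL P e x := (zpow_le_zpow (by omega)).trans hn
  have hy : GroupLeL P e y := (zpow_le_zpow (by omega)).trans hm
  obtain ⟨d, h1, h2, h3⟩ := hG.garsideMonoid.lattice_left.exists_join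
    ⟨_, groupLeL_iff.1 hx⟩ ⟨_, groupLeL_iff.1 hy⟩
  rw [leL_coe_iff] at h1 h2
  refine ⟨e * d, ?_, ?_, fun z hxz hyz => ?_⟩
  · rwa [← groupLeL_mul_left_iff (a := e⁻¹), inv_mul_cancel_left]
  · rwa [← groupLeL_mul_left_iff (a := e⁻¹), inv_mul_cancel_left]
  · have h4 := h3 ⟨_, groupLeL_iff.1 (hx.trans hxz)⟩
    rw [leL_coe_iff, leL_coe_iff, leL_coe_iff] at h4
    rw [← groupLeL_mul_left_iff (a := e⁻¹), inv_mul_cancel_left]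
    exact h4 (groupLeL_mul_left_iff.2 hxz) (groupLeL_mul_left_iff.2 hyz)

theorem natNorm_lt {a b : P} (h : GroupLeL P (a : G) b) (hne : a ≠ b) : natNorm a < natNorm b := by
  obtain ⟨c, rfl⟩ := leL_coe_iff.2 h
  have h1 := hG.garsideMonoid.atomic.natNorm_add_le a c
  by_contra! hle
  have h2 := hG.garsideMonoid.atomic.eq_one_of_natNorm_eq_zero (a := c) (by omega)
  simp [h2] at hne

omit hG in
open Classical in
variable (P) in
/-- The norm of `g⁻¹h` if `g ≤_L h`. -/
noncomputable def relNorm (g h : G) : ℕ :=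
  if hp : g⁻¹ * h ∈ P then natNorm (⟨_, hp⟩ : P) else 0

theorem eq_of_relNorm_le {b x y : G} (h1 : GroupLeL P b x) (h2 : GroupLeL P x y)
    (h : relNorm P b y ≤ relNorm P b x) : x = y := by
  by_contra hne
  have h3 := groupLeL_iff.1 h1
  have h4 := groupLeL_iff.1 (h1.trans h2)
  rw [relNorm, relNorm, dif_pos h3, dif_pos h4] at h
  refine absurd (hG.natNorm_lt (a := ⟨_, h3⟩) (b := ⟨_, h4⟩) (groupLeL_mul_left_iff.2 h2) ?_)
    h.not_gt
  intro he
  exact hne (mul_left_cancel (congrArg Subtype.val he))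

theorem relNorm_le {b x y : G} (h1 : GroupLeL P b x) (h2 : GroupLeL P x y) :
    relNorm P b x ≤ relNorm P b y := by
  by_contra! h
  have := hG.eq_of_relNorm_le h1 h2 h.le
  exact absurd (this ▸ h) (lt_irrefl _)

/-- A nonempty set with a lower bound has a greatest lower bound. -/
theorem exists_glb {S : Set G} (hne : S.Nonempty) {b : G} (hb : ∀ x ∈ S, GroupLeL P b x) :
    ∃ d, (∀ x ∈ S, GroupLeL P d x) ∧ ∀ z, (∀ x ∈ S, GroupLeL P z x) → GroupLeL P z d := by
  classical
  obtain ⟨x₀, hx₀⟩ := hne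
  -- Among the lower bounds above `b`, take one of maximal norm relative to `b`, measured by its
  -- deficiency from `x₀`. Joining it with another lower bound cannot increase the norm, hence does
  -- not change it.
  have hex : ∃ n, ∃ y, (∀ x ∈ S, GroupLeL P y x) ∧ GroupLeL P b y ∧
      relNorm P b x₀ - relNorm P b y = n := ⟨_, b, hb, GroupLeL.refl b, rfl⟩
  obtain ⟨y, hy, hby, hn⟩ := Nat.find_spec hex
  refine ⟨y, hy, fun z hz => ?_⟩
  obtain ⟨j, hyj, hzj, hj⟩ := hG.exists_join y z
  have hjS : ∀ x ∈ S, GroupLeL P j x := fun x hx => hj x (hy x hx) (hz x hx)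
  have h1 := Nat.find_min' hex ⟨j, hjS, hby.trans hyj, rfl⟩
  have h2 := hG.relNorm_le hby (hy x₀ hx₀)
  have h3 := hG.relNorm_le (hby.trans hyj) (hjS x₀ hx₀)
  rw [hG.eq_of_relNorm_le hby hyj (by omega)]
  exact hzj

/-- A nonempty set with an upper bound has a least upper bound. -/
theorem exists_lub {S : Set G} (hne : S.Nonempty) {b : G} (hb : ∀ x ∈ S, GroupLeL P x b) :
    ∃ d, (∀ x ∈ S, GroupLeL P x d) ∧ ∀ z, (∀ x ∈ S, GroupLeL P x z) → GroupLeL P d z := by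
  obtain ⟨x₀, hx₀⟩ := hne
  obtain ⟨d, h1, h2⟩ := hG.exists_glb (S := {z | ∀ x ∈ S, GroupLeL P x z}) ⟨b, hb⟩ (b := x₀)
    fun z hz => hz x₀ hx₀
  exact ⟨d, fun x hx => h2 x fun z hz => hz x hx, fun z hz => h1 z hz⟩

theorem exists_meet (x y : G) : ∃ d, GroupLeL P d x ∧ GroupLeL P d y ∧
    ∀ z, GroupLeL P z x → GroupLeL P z y → GroupLeL P z d := by
  obtain ⟨n, hn, -⟩ := hG.exists_bounds x
  obtain ⟨m, hm, -⟩ := hG.exists_bounds y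
  obtain ⟨d, h1, h2⟩ := hG.exists_glb (S := {x, y}) ⟨x, by simp⟩
    (b := (Δ : G) ^ (-(max n m : ℕ) : ℤ)) (by
      rintro z (rfl | rfl)
      · exact (zpow_le_zpow (by omega)).trans hn
      · exact (zpow_le_zpow (by omega)).trans hm)
  refine ⟨d, h1 x (by simp), h1 y (by simp), fun z hx hy => h2 z ?_⟩
  rintro w (rfl | rfl) <;> assumption

end IsGarsideGroup

end Order

/-! ### Infima of powers, and the bound `‖Δ‖` on the exponents to be tested. -/

section Powers

variable {G : Type*} [Group G] {P : Submonoid G} {Δ : P}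

/-- Some conjugate of `h` is at least `Δ^z`; in other words, `z ≤ inf_s(h)`. -/
def ConjGE (Δ : P) (h : G) (z : ℤ) : Prop := ∃ u : G, GroupLeL P ((Δ : G) ^ z) (u⁻¹ * h * u)

/-- `inf(h)` is maximal on the conjugacy class of `h`. -/
def InfMax (Δ : P) (h : G) : Prop := ∀ z : ℤ, ConjGE Δ h z → GroupLeL P ((Δ : G) ^ z) h

namespace IsGarsideGroup

variable (hG : IsGarsideGroup P Δ)
include hG

/-- A filtration of the group by a rational lower bound `p/m` of the infimum of the powers. -/
theorem exists_filtration {h : G} {m : ℕ} (hm : 0 < m) {p : ℤ}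
    (hp : GroupLeL P ((Δ : G) ^ p) (h ^ m)) :
    ∃ B : ℤ → G, (∀ i j, i ≤ j → GroupLeL P (B i) (B j)) ∧ (∀ j, B (j + m) = B j * Δ) ∧
      ∀ j, GroupLeL P (B (j + p)) (h * B j) := by
  -- Here `h` has weight `p` and `Δ` has weight `m`, in accordance with `Δ^p ≤ hᵐ`.
  let S : ℤ → Set G := fun j => {y | ∃ (n : ℕ) (k : ℤ), j ≤ n * p + k * m ∧
    y = h ^ n * (Δ : G) ^ k}
  have hmem : ∀ (j : ℤ) (n : ℕ) (k : ℤ), j ≤ n * p + k * m → h ^ n * (Δ : G) ^ k ∈ S j :=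
    fun j n k hj => ⟨n, k, hj, rfl⟩
  have hne : ∀ j, (S j).Nonempty := fun j => ⟨_, hmem j 0 |j| (by
    have := le_abs_self j
    have := abs_nonneg j
    push_cast
    nlinarith)⟩
  choose c hc using fun b : ℕ => hG.exists_bounds (h ^ b)
  have hbd : ∀ j, ∃ b : G, ∀ x ∈ S j, GroupLeL P b x := by
    intro j
    -- Write `n = b + ma` with `0 ≤ b < m`. The sum bounds `h^b` from below for all residues `b` at
    -- once. The remaining factor is at least `Δ^(ap + k)`, and `j ≤ np + km` forces `ap + k ≥ -|j|
    -- - |p|`.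
    refine ⟨(Δ : G) ^ (-(∑ i ∈ Finset.range m, c i : ℕ) + (-|j| - |p|)), ?_⟩
    rintro _ ⟨n, k, hnk, rfl⟩
    have hlt := Nat.mod_lt n hm
    have h1 : GroupLeL P ((Δ : G) ^ (-(∑ i ∈ Finset.range m, c i : ℕ) : ℤ)) (h ^ (n % m)) := by
      refine (zpow_le_zpow ?_).trans (hc (n % m)).1
      have := Finset.single_le_sum (f := c) (fun i _ => Nat.zero_le _) (Finset.mem_range.2 hlt)
      omega
    have h2 := hG.zpow_le_pow hp (n / m)
    have h3 := hG.zpow_add_le_mul h1 (hG.zpow_add_le_mul h2 (GroupLeL.refl ((Δ : G) ^ k)))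
    rw [← pow_mul, ← mul_assoc, ← pow_add, Nat.mod_add_div] at h3
    refine (zpow_le_zpow ?_).trans h3
    have hn : (n : ℤ) = (n % m : ℕ) + m * (n / m : ℕ) := by
      exact_mod_cast (Nat.mod_add_div n m).symm
    set a : ℤ := ((n / m : ℕ) : ℤ)
    set b : ℤ := ((n % m : ℕ) : ℤ)
    have hb : 0 ≤ b ∧ b ≤ m := ⟨by positivity, Int.ofNat_le.2 hlt.le⟩
    have hbp : b * p ≤ m * |p| :=
      (mul_le_mul_of_nonneg_left (le_abs_self p) hb.1).trans
        (mul_le_mul_of_nonneg_right hb.2 (abs_nonneg p))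
    have hj := neg_abs_le j
    have h4 : -|j| ≤ (a * p + k + |p|) * m := by rw [hn] at hnk; nlinarith
    have h5 : -|j| ≤ a * p + k + |p| := by
      by_contra! hlt
      have h0 := abs_nonneg j
      have : (1 : ℤ) ≤ m := by exact_mod_cast hm
      nlinarith
    linarith
  choose b hb using hbd
  choose B hB1 hB2 using fun j => hG.exists_glb (hne j) (hb j)
  refine ⟨B, fun i j hij => hB2 _ _ ?_, fun j => hG.antisymm ?_ (hB2 _ _ ?_), fun j => ?_⟩
  · rintro _ ⟨n, k, hnk, rfl⟩
    exact hB1 _ _ (hmem _ _ _ (hij.trans hnk))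
  · rw [← hG.mul_zpow_le_iff (-1)]
    have : GroupLeL P (B (j + m) * (Δ : G) ^ (-1 : ℤ)) (B j) := by
      refine hB2 _ _ ?_
      rintro _ ⟨n, k, hnk, rfl⟩
      rw [← hG.mul_zpow_le_iff 1]
      have := hB1 _ _ (hmem (j + m) n (k + 1) (by linarith))
      rw [zpow_add] at this
      simpa [mul_assoc] using this
    simpa using this
  · rintro _ ⟨n, k, hnk, rfl⟩
    have := hB1 _ _ (hmem j n (k - 1) (by linarith))
    rw [← hG.mul_zpow_le_iff 1, mul_assoc (h ^ n), ← zpow_add] at this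
    simpa using this
  · rw [← groupLeL_mul_left_iff (a := h⁻¹), inv_mul_cancel_left]
    refine hB2 _ _ ?_
    rintro _ ⟨n, k, hnk, rfl⟩
    rw [← groupLeL_mul_left_iff (a := h), mul_inv_cancel_left]
    have := hB1 _ _ (hmem (j + p) (n + 1) k (by push_cast; linarith))
    rwa [pow_succ', mul_assoc] at this

/-- The filtration, up to conjugation. -/
theorem exists_filtration_of_conjGE {h : G} {m : ℕ} (hm : 0 < m) {p : ℤ}
    (hp : ConjGE Δ (h ^ m) p) :
    ∃ (v : G) (B : ℤ → G), (∀ i j, i ≤ j → GroupLeL P (B i) (B j)) ∧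
      (∀ j, B (j + m) = B j * Δ) ∧ (∀ j z : ℤ, B (j + z * m) = B j * (Δ : G) ^ z) ∧
      ∀ (j : ℤ) (n : ℕ), GroupLeL P (B (j + n * p)) (v⁻¹ * h ^ n * v * B j) := by
  obtain ⟨v, hv⟩ := hp
  have hpow : ∀ n : ℕ, (v⁻¹ * h * v) ^ n = v⁻¹ * h ^ n * v := fun n => by
    simpa using conj_pow (a := v⁻¹) (b := h) (i := n)
  obtain ⟨B, h1, h2, h3⟩ := hG.exists_filtration (h := v⁻¹ * h * v) hm (by rwa [hpow])
  refine ⟨v, B, h1, h2, fun j z => ?_, fun j n => ?_⟩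
  · induction z with
    | zero => simp
    | succ n ih =>
      rw [add_mul, one_mul, ← add_assoc, h2, ih, zpow_add, zpow_one, mul_assoc]
    | pred n ih =>
      rw [← mul_left_inj (Δ : G), ← h2, sub_mul, one_mul, add_assoc, sub_add_cancel, ih,
        zpow_sub, zpow_one, mul_assoc, inv_mul_cancel_right]
  · rw [← hpow]
    induction n with
    | zero => simpa using GroupLeL.refl _
    | succ n ih =>
      have h4 := h3 (j + n * p)
      rw [show j + (n : ℤ) * p + p = j + (n + 1 : ℕ) * p by push_cast; ring] at h4
      rw [pow_succ', mul_assoc]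
      exact h4.trans (groupLeL_mul_left_iff.2 ih)

omit hG in
theorem conjGE_of_le {h v b : G} {z : ℤ}
    (H : GroupLeL P (b * (Δ : G) ^ z) (v⁻¹ * h * v * b)) : ConjGE Δ h z := by
  rw [← groupLeL_mul_left_iff (a := b⁻¹), inv_mul_cancel_left] at H
  exact ⟨v * b, by simpa [mul_assoc] using H⟩

/-- In the filtration, `B 0 * Δ^z = B (zm) ≤ B (np)`, and `B (np)` lies below the conjugated `hⁿ`
times `B 0`. Thus a ratio `p/m` attained for one exponent gives every integer `z ≤ np/m` for the
exponent `n`. -/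
theorem conjGE_pow_of_mul_le {h : G} {m n : ℕ} (hm : 0 < m) {p z : ℤ} (hp : ConjGE Δ (h ^ m) p)
    (hz : z * m ≤ n * p) : ConjGE Δ (h ^ n) z := by
  obtain ⟨v, B, h1, -, h3, h4⟩ := hG.exists_filtration_of_conjGE hm hp
  refine conjGE_of_le (v := v) (b := B 0) ?_
  rw [← h3]
  exact (h1 _ _ (by linarith)).trans (h4 0 n)

/-- A pigeonhole argument: from `B 0` to `B 0 * Δ` there are `m > ‖Δ‖` steps, and each strict step
raises the norm relative to `B 0`. So some step is an equality, and the unit of index gained there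
makes up the missing `1` in `np + 1 = zm`. -/
theorem exists_smaller_of_coprime {h : G} {m : ℕ} (hm : natNorm Δ < m) {p : ℤ}
    (hp : ConjGE Δ (h ^ m) p) {n : ℕ} {z : ℤ} (hn : n * p + 1 = z * m) :
    ConjGE Δ (h ^ n) z := by
  obtain ⟨v, B, h1, h2, h3, h4⟩ := hG.exists_filtration_of_conjGE (by omega) hp
  have hcst : ∃ j : ℕ, B j = B (j + 1) := by
    by_contra! hne
    have hgrow : ∀ j : ℕ, j ≤ relNorm P (B 0) (B j) := by
      intro j
      induction j with
      | zero => exact Nat.zero_le _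
      | succ j ih =>
        by_contra! hlt
        refine hne j ?_
        have := hG.eq_of_relNorm_le (h1 0 j (by positivity)) (h1 j (j + 1) (by omega)) (by
          push_cast at hlt
          omega)
        exact this
    have h5 := hgrow m
    have h6 := h2 0
    rw [zero_add] at h6
    have h7 : (B 0)⁻¹ * (B 0 * Δ) ∈ P := by simp
    rw [h6, relNorm, dif_pos h7] at h5
    have h8 : (⟨_, h7⟩ : P) = Δ := Subtype.ext (by simp)
    rw [h8] at h5
    omega
  obtain ⟨j, hj⟩ := hcst
  refine conjGE_of_le (v := v) (b := B j) ?_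
  rw [← h3, ← hn]
  have := h4 (j + 1) n
  rw [← hj] at this
  rwa [show (j : ℤ) + 1 + n * p = j + (n * p + 1) by ring] at this

/-- Descent on the exponent `m`, never decreasing the ratio `p/m`: a fraction that is not in lowest
terms is reduced, and one in lowest terms with `m > ‖Δ‖` is replaced by a strictly larger one of
smaller denominator. -/
theorem exists_le_natNorm {h : G} (hN : 0 < natNorm Δ) (m : ℕ) (hm : 0 < m) (p : ℤ)
    (hp : ConjGE Δ (h ^ m) p) :
    ∃ q : ℕ, 0 < q ∧ q ≤ natNorm Δ ∧ ∃ z : ℤ, ConjGE Δ (h ^ q) z ∧ p * q ≤ z * m := by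
  induction m using Nat.strong_induction_on generalizing p with
  | _ m ih =>
    rcases le_or_gt m (natNorm Δ) with hle | hlt
    · exact ⟨m, hm, hle, p, hp, le_rfl⟩
    have hm' : (0 : ℤ) < m := by exact_mod_cast hm
    -- it suffices to find a smaller exponent with a ratio at least as large
    have key : ∀ n : ℕ, 0 < n → n < m → ∀ z : ℤ, ConjGE Δ (h ^ n) z → p * n ≤ z * m →
        ∃ q : ℕ, 0 < q ∧ q ≤ natNorm Δ ∧ ∃ z : ℤ, ConjGE Δ (h ^ q) z ∧ p * q ≤ z * m := by
      intro n hn hnm z hz hle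
      obtain ⟨q, hq, hqN, w, hw, hle'⟩ := ih n hnm hn z hz
      refine ⟨q, hq, hqN, w, hw, ?_⟩
      have hn' : (0 : ℤ) < n := by exact_mod_cast hn
      refine le_of_mul_le_mul_right ?_ hn'
      calc p * q * n = p * n * q := by ring
        _ ≤ z * m * q := mul_le_mul_of_nonneg_right hle (by positivity)
        _ = z * q * m := by ring
        _ ≤ w * n * m := mul_le_mul_of_nonneg_right hle' hm'.le
        _ = w * m * n := by ring
    by_cases hco : IsCoprime p m
    · obtain ⟨a, b, hab⟩ := hco
      -- From `ap + bm = 1`, the residue `n` of `-a` modulo `m` satisfies `np ≡ -1`, which is what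
      -- `exists_smaller_of_coprime` needs.
      have hmod : ∃ k : ℤ, (-a) = m * k + (-a) % m := ⟨(-a) / m, (Int.mul_ediv_add_emod _ _).symm⟩
      obtain ⟨k, hk⟩ := hmod
      obtain ⟨n, hn⟩ := Int.eq_ofNat_of_zero_le (Int.emod_nonneg (-a) hm'.ne')
      have hnm : (n : ℤ) < m := hn ▸ Int.emod_lt_of_pos (-a) hm'
      have hz : (n : ℤ) * p + 1 = (b - k * p) * m := by
        rw [hn] at hk
        have : (n : ℤ) = -a - m * k := by omega
        rw [this]
        linear_combination (-1 : ℤ) * hab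
      refine key n ?_ (by omega) (b - k * p) (hG.exists_smaller_of_coprime hlt hp hz)
        (by linarith)
      -- The case `n = 0` would make `m` divide `1`, against `m > ‖Δ‖ ≥ 1`.
      rcases Nat.eq_zero_or_pos n with h0 | h0
      · exfalso
        subst h0
        have h1 : (m : ℤ) ∣ 1 := ⟨b - k * p, by push_cast at hz; linarith⟩
        have := Int.le_of_dvd one_pos h1
        omega
      · exact h0
    · rw [Int.isCoprime_iff_gcd_eq_one] at hco
      obtain ⟨r, hr⟩ := Int.gcd_dvd_left p m
      obtain ⟨n, hn⟩ : Int.gcd p m ∣ m := by exact_mod_cast Int.gcd_dvd_right p m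
      set d := Int.gcd p m
      have hd : 0 < d := Nat.pos_of_ne_zero fun h0 => by rw [h0, zero_mul] at hn; omega
      have hn0 : 0 < n := Nat.pos_of_ne_zero fun h0 => by rw [h0, mul_zero] at hn; omega
      refine key n hn0 ?_ r (hG.conjGE_pow_of_mul_le hm hp ?_) ?_
      · rw [hn]
        exact lt_mul_of_one_lt_left hn0 (by omega)
      · rw [hr, hn]; push_cast; exact le_of_eq (by ring)
      · rw [hr, hn]; push_cast; exact le_of_eq (by ring)

/-- The infimum of all powers is maximal if that of the first `‖Δ‖` powers is. -/
theorem infMax_pow_of_le_natNorm {h : G} (hN : 0 < natNorm Δ)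
    (H : ∀ n : ℕ, 1 ≤ n → n ≤ natNorm Δ → InfMax Δ (h ^ n)) (n : ℕ) (hn : 1 ≤ n) :
    InfMax Δ (h ^ n) := by
  induction n using Nat.strong_induction_on with
  | _ n ih =>
    rcases le_or_gt n (natNorm Δ) with hle | hlt
    · exact H n hn hle
    intro z hz
    -- As `w/q ≥ z/n`, also `(z - w) * q ≤ (n - q) * w`, so some conjugate of `h^(n - q)` is at
    -- least `Δ^(z - w)`. By maximality `h^q` and `h^(n - q)` themselves satisfy their bounds, and
    -- these multiply.
    obtain ⟨q, hq, hqN, w, hw, hle⟩ := hG.exists_le_natNorm hN n hn z hz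
    have hqn : q < n := by omega
    have h1 := H q hq hqN w hw
    have h2 := ih (n - q) (by omega) (by omega) (z - w)
      (hG.conjGE_pow_of_mul_le hq hw (by rw [Nat.cast_sub hqn.le]; linarith))
    have h3 := hG.zpow_add_le_mul h2 h1
    rwa [sub_add_cancel, ← pow_add, Nat.sub_add_cancel hqn.le] at h3

/-! ### Order-theoretic description of the super summit set. -/

theorem delta_ne_one_iff : (Δ : G) ≠ 1 ↔ 0 < natNorm Δ := by
  rw [Nat.pos_iff_ne_zero, ne_eq, not_iff_not]
  constructor
  · intro h
    have h1 : Δ = 1 := Subtype.ext h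
    have := hG.garsideMonoid.atomic.natNorm_add_le (1 : P) 1
    rw [mul_one] at this
    rw [h1]
    omega
  · intro h
    rw [hG.garsideMonoid.atomic.eq_one_of_natNorm_eq_zero h]
    rfl

theorem subsingleton_of_delta_eq_one (hΔ : (Δ : G) = 1) : Subsingleton G := by
  refine ⟨fun a b => ?_⟩
  have : ∀ g : G, g = 1 := fun g => by
    obtain ⟨n, h1, h2⟩ := hG.exists_bounds g
    rw [hΔ, one_zpow] at h1 h2
    exact hG.antisymm h2 h1
  rw [this a, this b]

/-- Conjugation by `u` changes the infimum by a bounded amount, whereas an excess of `r` over `s`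
grows linearly in the powers of `x`. -/
theorem le_of_conjGE (hΔ : (Δ : G) ≠ 1) {x : G} {r s : ℤ} (h1 : ConjGE Δ x r)
    (h2 : GroupLeL P x ((Δ : G) ^ s)) : r ≤ s := by
  obtain ⟨u, hu⟩ := h1
  obtain ⟨c, hc1, hc2⟩ := hG.exists_bounds u
  rw [hG.le_zpow_iff_inv] at h2 hc2
  -- The factors `u` and `u⁻¹` together cost at most `2c`, so `nr - 2c ≤ ns`. This excludes `r ≥ s +
  -- 1` as soon as `n > 2c`.
  set n := 2 * c + 1
  have h3 := hG.zpow_add_le_mul hc1 (hG.zpow_add_le_mul (hG.zpow_le_pow hu n) hc2)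
  have h4 := hG.zpow_le_pow h2 n
  have h5 : u * ((u⁻¹ * x * u) ^ n * u⁻¹) = x ^ n := by
    have := conj_pow (a := u⁻¹) (b := x) (i := n)
    rw [inv_inv] at this
    rw [this]
    group
  rw [h5] at h3
  rw [inv_pow, mul_neg, ← hG.le_zpow_iff_inv] at h4
  have h6 := (hG.zpow_le_zpow_iff hΔ).1 (h3.trans h4)
  by_contra! hlt
  have : (n : ℤ) * (s + 1) ≤ n * r := mul_le_mul_of_nonneg_left hlt (by positivity)
  have hn : (n : ℤ) = 2 * c + 1 := by simp [n]
  rw [mul_add] at this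
  omega

theorem le_infG_iff (hΔ : (Δ : G) ≠ 1) {g : G} {r : ℤ} :
    r ≤ infG P Δ g ↔ GroupLeL P ((Δ : G) ^ r) g := by
  obtain ⟨n, hn1, hn2⟩ := hG.exists_bounds g
  have hb : BddAbove {r : ℤ | GroupLeL P ((Δ : G) ^ r) g} :=
    ⟨n, fun r hr => (hG.zpow_le_zpow_iff hΔ).1 (GroupLeL.trans hr hn2)⟩
  constructor
  · intro h
    exact (zpow_le_zpow h).trans (Int.csSup_mem ⟨_, hn1⟩ hb)
  · intro h
    exact le_csSup hb h

theorem bddAbove_infG (hΔ : (Δ : G) ≠ 1) (g : G) : BddAbove (infG P Δ '' conjugatesOf g) := by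
  obtain ⟨n, -, hn⟩ := hG.exists_bounds g
  refine ⟨n, ?_⟩
  rintro _ ⟨h, hh, rfl⟩
  obtain ⟨c, rfl⟩ := isConj_iff.1 hh
  exact hG.le_of_conjGE hΔ ⟨c⁻¹, by simpa using (hG.le_infG_iff hΔ).1 le_rfl⟩ hn

theorem le_infS_iff (hΔ : (Δ : G) ≠ 1) {g : G} {r : ℤ} :
    r ≤ infS P Δ g ↔ ConjGE Δ g r := by
  have hb := hG.bddAbove_infG hΔ g
  constructor
  · intro h
    obtain ⟨y, hy, h1⟩ := Int.csSup_mem ⟨_, Set.mem_image_of_mem _ (mem_conjugatesOf_self)⟩ hb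
    obtain ⟨c, rfl⟩ := isConj_iff.1 hy
    have h2 : r ≤ infG P Δ (c * g * c⁻¹) := h.trans_eq h1.symm
    exact ⟨c⁻¹, by simpa using (hG.le_infG_iff hΔ).1 h2⟩
  · rintro ⟨u, hu⟩
    exact ((hG.le_infG_iff hΔ).2 hu).trans
      (le_csSup hb ⟨_, isConj_iff.2 ⟨u⁻¹, by simp⟩, rfl⟩)

theorem supG_eq_neg_infG (hΔ : (Δ : G) ≠ 1) (g : G) : supG P Δ g = -infG P Δ g⁻¹ := by
  obtain ⟨n, hn1, hn2⟩ := hG.exists_bounds g⁻¹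
  rw [supG, infG, ← csInf_neg]
  · congr 1
    ext r
    exact hG.le_zpow_iff_inv
  · exact ⟨_, hn1⟩
  · exact ⟨n, fun r hr => (hG.zpow_le_zpow_iff hΔ).1 (GroupLeL.trans hr hn2)⟩

theorem supS_eq_neg_infS (hΔ : (Δ : G) ≠ 1) (g : G) : supS P Δ g = -infS P Δ g⁻¹ := by
  rw [supS, infS, ← csInf_neg]
  · congr 1
    ext r
    constructor
    · rintro ⟨h, hh, rfl⟩
      obtain ⟨c, rfl⟩ := isConj_iff.1 hh
      refine ⟨_, isConj_iff.2 ⟨c, rfl⟩, ?_⟩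
      rw [hG.supG_eq_neg_infG hΔ]
      simp [mul_assoc]
    · rintro ⟨h, hh, h1⟩
      obtain ⟨c, rfl⟩ := isConj_iff.1 hh
      refine ⟨_, isConj_iff.2 ⟨c, rfl⟩, ?_⟩
      rw [hG.supG_eq_neg_infG hΔ, neg_eq_iff_eq_neg, ← h1]
      simp [mul_assoc]
  · exact ⟨_, Set.mem_image_of_mem _ (mem_conjugatesOf_self)⟩
  · exact hG.bddAbove_infG hΔ _

omit hG in
theorem conjGE_congr {x y : G} (h : IsConj x y) {z : ℤ} (H : ConjGE Δ x z) : ConjGE Δ y z := by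
  obtain ⟨c, rfl⟩ := isConj_iff.1 h
  obtain ⟨u, hu⟩ := H
  exact ⟨c * u, by simpa [mul_assoc] using hu⟩

theorem infG_eq_infS_iff (hΔ : (Δ : G) ≠ 1) {x y : G} (hxy : IsConj x y) :
    infG P Δ y = infS P Δ x ↔ InfMax Δ y := by
  constructor
  · intro h z hz
    rw [← hG.le_infG_iff hΔ, h, hG.le_infS_iff hΔ]
    exact conjGE_congr hxy.symm hz
  · intro h
    refine le_antisymm (le_csSup (hG.bddAbove_infG hΔ x) ⟨y, hxy, rfl⟩) ?_
    rw [hG.le_infG_iff hΔ]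
    exact h _ (conjGE_congr hxy ((hG.le_infS_iff hΔ).1 le_rfl))

/-- `sup` is minimal exactly where the `inf` of the inverse is maximal. If `Δ = 1`, the sets of
exponents are unbounded and `sSup`, `sInf` take default values, but then the group is trivial and
both sides hold. -/
theorem mem_superSummitSet_iff {x y : G} :
    y ∈ superSummitSet P Δ x ↔ IsConj x y ∧ InfMax Δ y ∧ InfMax Δ y⁻¹ := by
  by_cases hΔ : (Δ : G) = 1
  · have := hG.subsingleton_of_delta_eq_one hΔ
    have hx : ∀ f : G → ℤ, f '' conjugatesOf x = {f y} := by
      intro f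
      ext r
      constructor
      · rintro ⟨a, -, rfl⟩
        rw [Subsingleton.elim a y]; rfl
      · rintro rfl
        exact ⟨x, mem_conjugatesOf_self, by rw [Subsingleton.elim x y]⟩
    have hmax : ∀ a : G, InfMax Δ a := fun a z _ => by
      rw [Subsingleton.elim a ((Δ : G) ^ z)]; exact GroupLeL.refl _
    have hc : IsConj x y := by rw [Subsingleton.elim x y]
    refine iff_of_true ⟨hc, ?_, ?_⟩ ⟨hc, hmax _, hmax _⟩
    · rw [infS, hx, csSup_singleton]
    · rw [supS, hx, csInf_singleton]
  · refine and_congr_right fun hxy => ?_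
    have hxy' : IsConj x⁻¹ y⁻¹ := by
      obtain ⟨c, rfl⟩ := isConj_iff.1 hxy
      exact isConj_iff.2 ⟨c, by simp [mul_assoc]⟩
    rw [← hG.infG_eq_infS_iff hΔ hxy, ← hG.infG_eq_infS_iff hΔ hxy', hG.supG_eq_neg_infG hΔ,
      hG.supS_eq_neg_infS hΔ, neg_inj]

/-- Stable super summit elements are characterized by the powers up to any bound `k ≥ ‖Δ‖`. -/
theorem mem_stableSuperSummitSet_iff {k : ℕ} (hk : natNorm Δ ≤ k) {g h : G} :
    h ∈ stableSuperSummitSet P Δ g ↔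
      ∀ n : ℕ, 1 ≤ n → n ≤ k → h ^ n ∈ superSummitSet P Δ (g ^ n) := by
  by_cases hΔ : (Δ : G) = 1
  · have := hG.subsingleton_of_delta_eq_one hΔ
    have hall : ∀ x y : G, y ∈ superSummitSet P Δ x := fun x y => by
      rw [hG.mem_superSummitSet_iff]
      have hmax : ∀ a : G, InfMax Δ a := fun a z _ => by
        rw [Subsingleton.elim a ((Δ : G) ^ z)]; exact GroupLeL.refl _
      exact ⟨by rw [Subsingleton.elim x y], hmax _, hmax _⟩
    exact ⟨fun _ _ _ _ => hall _ _, fun _ => ⟨hall _ _, fun _ _ => hall _ _⟩⟩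
  · have hN := hG.delta_ne_one_iff.1 hΔ
    refine ⟨fun H n hn _ => H.2 n hn, fun H => ?_⟩
    have h1 := H 1 le_rfl (by omega)
    rw [pow_one, pow_one] at h1
    refine ⟨h1, fun n hn => hG.mem_superSummitSet_iff.2 ⟨?_, ?_, ?_⟩⟩
    · obtain ⟨c, rfl⟩ := isConj_iff.1 h1.1
      exact isConj_iff.2 ⟨c, by simp⟩
    · exact hG.infMax_pow_of_le_natNorm hN
        (fun n hn hnN => (hG.mem_superSummitSet_iff.1 (H n hn (by omega))).2.1) n hn
    · rw [← inv_pow]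
      refine hG.infMax_pow_of_le_natNorm hN (fun n hn hnN => ?_) n hn
      rw [inv_pow]
      exact (hG.mem_superSummitSet_iff.1 (H n hn (by omega))).2.2

end IsGarsideGroup

end Powers

/-! ### Conjugates in a bounded range: connectedness, finiteness, and completeness of closed lists.
-/

section Conjugacy

variable {G : Type*} [Group G] {P : Submonoid G} {Δ : P}

/-- `-m ≤ inf(x)` and `sup(x) ≤ m`. -/
def InRange (Δ : P) (m : ℕ) (x : G) : Prop :=
  GroupLeL P ((Δ : G) ^ (-m : ℤ)) x ∧ GroupLeL P x ((Δ : G) ^ (m : ℤ))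

/-- A set of conjugating elements that describes all conjugates of `x` in a range. -/
structure IsConjList (Δ : P) (m : ℕ) (x : G) (U : Set G) : Prop where
  one_mem : 1 ∈ U
  inRange : ∀ u ∈ U, InRange Δ m (u⁻¹ * x * u)
  closed : ∀ u ∈ U, ∀ a : G, a ∈ simples P Δ ∨ a⁻¹ ∈ simples P Δ →
    InRange Δ m ((u * a)⁻¹ * x * (u * a)) → ∃ v ∈ U, v⁻¹ * x * v = (u * a)⁻¹ * x * (u * a)

namespace IsGarsideGroup

variable (hG : IsGarsideGroup P Δ)
include hG

theorem zpow_le_conj_iff {x u : G} {r : ℤ} :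
    GroupLeL P ((Δ : G) ^ r) (u⁻¹ * x * u) ↔ GroupLeL P u (x * u * (Δ : G) ^ (-r)) := by
  rw [← hG.mul_zpow_le_iff (-r), ← groupLeL_mul_left_iff (a := u)]
  simp [mul_assoc]

theorem conj_le_zpow_iff {x u : G} {r : ℤ} :
    GroupLeL P (u⁻¹ * x * u) ((Δ : G) ^ r) ↔ GroupLeL P (x * u * (Δ : G) ^ (-r)) u := by
  rw [← hG.mul_zpow_le_iff (-r), ← groupLeL_mul_left_iff (a := u)]
  simp [mul_assoc]

theorem inRange_delta_zpow_conj {m : ℕ} {x : G} (h : InRange Δ m x) (z : ℤ) :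
    InRange Δ m (((Δ : G) ^ z)⁻¹ * x * (Δ : G) ^ z) := by
  have he : ∀ k : ℤ, ((Δ : G) ^ z)⁻¹ * (Δ : G) ^ k * (Δ : G) ^ z = (Δ : G) ^ k := fun k => by
    rw [← zpow_neg, ← zpow_add, ← zpow_add]
    congr 1
    ring
  refine ⟨?_, ?_⟩
  · rw [← he]
    exact (hG.shift_le_iff _ _).2 h.1
  · rw [← he m]
    exact (hG.shift_le_iff _ _).2 h.2

/-- Both bounds on `u⁻¹xu` compare `u` with `x * u * Δ^(-r)`, for `r = -m` and `r = m`. The map `u ↦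
x * u * Δ^(-r)` is an order automorphism, so either comparison passes to meets. -/
theorem inRange_conj_meet {m : ℕ} {x u v d : G} (hu : InRange Δ m (u⁻¹ * x * u))
    (hv : InRange Δ m (v⁻¹ * x * v)) (hdu : GroupLeL P d u) (hdv : GroupLeL P d v)
    (hd : ∀ z, GroupLeL P z u → GroupLeL P z v → GroupLeL P z d) :
    InRange Δ m (d⁻¹ * x * d) := by
  refine ⟨?_, ?_⟩
  · have h1 := hdu.trans (hG.zpow_le_conj_iff.1 hu.1)
    have h2 := hdv.trans (hG.zpow_le_conj_iff.1 hv.1)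
    rw [hG.zpow_le_conj_iff]
    rw [← hG.shift_le_iff x⁻¹ (-m)] at h1 h2 ⊢
    simp only [mul_assoc, inv_mul_cancel_left, ← zpow_add, neg_neg, add_neg_cancel, zpow_zero,
      mul_one] at h1 h2 ⊢
    exact hd _ h1 h2
  · rw [hG.conj_le_zpow_iff]
    exact hd _ (((hG.shift_le_iff x _).2 hdu).trans (hG.conj_le_zpow_iff.1 hu.2))
      (((hG.shift_le_iff x _).2 hdv).trans (hG.conj_le_zpow_iff.1 hv.2))

theorem exists_simple_le {u : G} (hu : u ∈ P) (hne : u ≠ 1) :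
    ∃ a ∈ simples P Δ, a ≠ 1 ∧ GroupLeL P a u := by
  have : u = 1 ∨ u ∈ P ∧ ∃ a ∈ simples P Δ, a ≠ 1 ∧ GroupLeL P a u := by
    refine hG.mem_induction (p := fun u => u = 1 ∨ u ∈ P ∧ ∃ a ∈ simples P Δ, a ≠ 1 ∧
      GroupLeL P a u) (fun a ha => ?_) (Or.inl rfl) ?_ hu
    · by_cases h : a = 1
      · exact Or.inl h
      · exact Or.inr ⟨(mem_simples_iff.1 ha).1, a, ha, h, GroupLeL.refl a⟩
    · rintro a b (rfl | ⟨h1, c, h2, h3, h4⟩) (rfl | ⟨h1', c', h2', h3', h4'⟩)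
      · simp
      · rw [one_mul]; exact Or.inr ⟨h1', c', h2', h3', h4'⟩
      · rw [mul_one]; exact Or.inr ⟨h1, c, h2, h3, h4⟩
      · exact Or.inr ⟨P.mul_mem h1 h1', c, h2, h3, h4.trans ⟨b, h1', rfl⟩⟩
  rcases this with h | h
  · exact absurd h hne
  · exact h.2

omit hG in
theorem delta_mem_simples : (Δ : G) ∈ simples P Δ := ⟨Δ, ⟨1, mul_one _⟩, rfl⟩

/-- A set that is closed under those conjugations by simple elements and their inverses that stay
in a given range contains, with an element, all its conjugates in that range. -/
theorem conj_mem_of_closed {m : ℕ} {S : Set G} (hr : ∀ z ∈ S, InRange Δ m z)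
    (h1 : ∀ z ∈ S, ∀ a ∈ simples P Δ, InRange Δ m (a⁻¹ * z * a) → a⁻¹ * z * a ∈ S)
    (h2 : ∀ z ∈ S, ∀ a ∈ simples P Δ, InRange Δ m (a * z * a⁻¹) → a * z * a⁻¹ ∈ S)
    {x u : G} (hx : x ∈ S) (hu : InRange Δ m (u⁻¹ * x * u)) : u⁻¹ * x * u ∈ S := by
  have hpos : ∀ (n : ℕ) (u : P), natNorm u = n → ∀ x ∈ S, InRange Δ m ((u : G)⁻¹ * x * u) →
      (u : G)⁻¹ * x * u ∈ S := by
    intro n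
    induction n using Nat.strong_induction_on with
    | _ n ih =>
      intro u hn x hx hu
      by_cases hu1 : (u : G) = 1
      · simpa [hu1] using hx
      -- Conjugation by `Δ` preserves the range, so the meet of `u` and `Δ` conjugates `x` into the
      -- range too. It is a nontrivial simple left factor of `u`, and splitting it off lowers the
      -- norm.
      obtain ⟨d, hdu, hdΔ, hd⟩ := hG.exists_meet (u : G) Δ
      have hdP : d ∈ P := one_groupLeL_iff.1
        (hd 1 (one_groupLeL_iff.2 u.2) (one_groupLeL_iff.2 Δ.2))
      have hds : d ∈ simples P Δ := mem_simples_iff.2 ⟨hdP, hdΔ⟩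
      have hd1 : d ≠ 1 := by
        rintro rfl
        obtain ⟨a, ha, hne, hau⟩ := hG.exists_simple_le u.2 hu1
        exact hne (hG.antisymm (hd a hau (mem_simples_iff.1 ha).2)
          (one_groupLeL_iff.2 (mem_simples_iff.1 ha).1))
      have hxd : InRange Δ m (d⁻¹ * x * d) := hG.inRange_conj_meet hu
        (by simpa using hG.inRange_delta_zpow_conj (hr x hx) 1) hdu hdΔ hd
      obtain ⟨c, hc, hdc⟩ := hdu
      have hlt : natNorm (⟨c, hc⟩ : P) < n := by
        have h3 := hG.garsideMonoid.atomic.natNorm_add_le ⟨d, hdP⟩ ⟨c, hc⟩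
        have h4 : (⟨d, hdP⟩ : P) * ⟨c, hc⟩ = u := Subtype.ext hdc
        rw [h4, hn] at h3
        have h5 : natNorm (⟨d, hdP⟩ : P) ≠ 0 := fun h0 => hd1
          (congrArg Subtype.val (hG.garsideMonoid.atomic.eq_one_of_natNorm_eq_zero h0))
        omega
      have h6 : (u : G)⁻¹ * x * u = c⁻¹ * (d⁻¹ * x * d) * c := by
        rw [← hdc]; group
      rw [h6] at hu ⊢
      exact ih _ hlt ⟨c, hc⟩ rfl _ (h1 x hx d hds hxd) hu
  -- A general `u` becomes positive after right multiplication by a power of `Δ`. That power is then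
  -- undone one `Δ` at a time without leaving the range.
  have hback : ∀ (n : ℕ) (y : G), InRange Δ m y →
      ((Δ : G) ^ (n : ℤ))⁻¹ * y * (Δ : G) ^ (n : ℤ) ∈ S → y ∈ S := by
    intro n
    induction n with
    | zero => intro y _ hS; simpa using hS
    | succ n ih =>
      intro y hy hS
      refine ih y hy ?_
      have h3 := h2 _ hS _ delta_mem_simples
      have h4 : (Δ : G) * (((Δ : G) ^ ((n + 1 : ℕ) : ℤ))⁻¹ * y * (Δ : G) ^ ((n + 1 : ℕ) : ℤ)) *
          (Δ : G)⁻¹ = ((Δ : G) ^ (n : ℤ))⁻¹ * y * (Δ : G) ^ (n : ℤ) := by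
        push_cast
        group
      rw [h4] at h3
      exact h3 (hG.inRange_delta_zpow_conj hy n)
  obtain ⟨n, hn, -⟩ := hG.exists_bounds u
  rw [← hG.mul_zpow_le_iff n, ← zpow_add, neg_add_cancel, zpow_zero, one_groupLeL_iff] at hn
  refine hback n _ hu ?_
  have h3 : ((Δ : G) ^ (n : ℤ))⁻¹ * (u⁻¹ * x * u) * (Δ : G) ^ (n : ℤ) =
      (u * (Δ : G) ^ (n : ℤ))⁻¹ * x * (u * (Δ : G) ^ (n : ℤ)) := by group
  have h4 := hG.inRange_delta_zpow_conj hu n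
  rw [h3] at h4 ⊢
  exact hpos _ ⟨_, hn⟩ rfl x hx h4

/-- The infimum can be raised by conjugation without raising the supremum. -/
theorem exists_conj_between {x : G} {r s : ℤ} (h1 : GroupLeL P x ((Δ : G) ^ s))
    (h2 : ConjGE Δ x r) : ∃ v : G, GroupLeL P ((Δ : G) ^ r) (v⁻¹ * x * v) ∧
      GroupLeL P (v⁻¹ * x * v) ((Δ : G) ^ s) := by
  obtain ⟨u, hu⟩ := h2
  obtain ⟨m, -, hm⟩ := hG.exists_bounds u
  -- The iterates of `u` under the order automorphism `v ↦ x * v * Δ^(-s)`. They are bounded above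
  -- because `x ≤ Δ^s`. Their join `d` satisfies `x * d * Δ^(-s) ≤ d`, that is `d⁻¹xd ≤ Δ^s`, and it
  -- inherits from the iterates the condition expressing `d⁻¹xd ≥ Δ^r`.
  let f : ℕ → G := fun i => x ^ i * u * (Δ : G) ^ (-(s * i))
  have hsucc : ∀ i, x * f i * (Δ : G) ^ (-s) = f (i + 1) := by
    intro i
    simp only [f, pow_succ', mul_assoc, ← zpow_add]
    congr 4
    push_cast
    ring
  have hbd : ∀ y ∈ Set.range f, GroupLeL P y ((Δ : G) ^ (m : ℤ)) := by
    rintro _ ⟨i, rfl⟩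
    induction i with
    | zero => simpa [f] using hm
    | succ i ih =>
      rw [← hsucc]
      refine ((hG.shift_le_iff x (-s)).2 ih).trans ?_
      rw [mul_assoc, ← zpow_add]
      have := (hG.mul_zpow_le_iff (m + -s)).2 h1
      rwa [← zpow_add, show s + ((m : ℤ) + -s) = m by ring] at this
  obtain ⟨d, hd1, hd2⟩ := hG.exists_lub (Set.range_nonempty f) hbd
  refine ⟨d, ?_, ?_⟩
  · rw [hG.zpow_le_conj_iff]
    refine hd2 _ ?_
    rintro _ ⟨i, rfl⟩
    refine GroupLeL.trans ?_ ((hG.shift_le_iff x (-r)).2 (hd1 _ ⟨i, rfl⟩))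
    rw [hG.zpow_le_conj_iff, ← hG.shift_le_iff (x ^ i) (-(s * i))] at hu
    have h3 : x ^ i * (x * u * (Δ : G) ^ (-r)) * (Δ : G) ^ (-(s * i)) =
        x * f i * (Δ : G) ^ (-r) := by
      simp only [f, mul_assoc, ← zpow_add]
      rw [add_comm, ← mul_assoc (x ^ i) x, ← pow_succ, pow_succ', mul_assoc]
    rwa [h3] at hu
  · rw [hG.conj_le_zpow_iff]
    have h3 : GroupLeL P d (x⁻¹ * d * (Δ : G) ^ s) := by
      refine hd2 _ ?_
      rintro _ ⟨i, rfl⟩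
      rw [← hG.shift_le_iff x (-s), hsucc]
      simpa [mul_assoc] using hd1 _ ⟨i + 1, rfl⟩
    rw [← hG.shift_le_iff x (-s)] at h3
    simpa [mul_assoc] using h3

/-- Up to a shift by `Δᵐ` these are positive elements below a power of `Δ`. If `1 ≤ y ≤ Δ^(n+1)` and
`d` is the meet of `y` and `Δ`, then `y * Δ^(-n)` lies below `y` and `Δ`, hence below `d`, so `d⁻¹y
≤ Δⁿ`. Thus `y` is a product of a simple element and an element of the previous stage. -/
theorem finite_inRange (hfin : (simples P Δ).Finite) (m : ℕ) : {x : G | InRange Δ m x}.Finite := by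
  have hpos : ∀ n : ℕ, {y : G | y ∈ P ∧ GroupLeL P y ((Δ : G) ^ (n : ℤ))}.Finite := by
    intro n
    induction n with
    | zero =>
      refine (Set.finite_singleton (1 : G)).subset ?_
      rintro y ⟨hy, hy'⟩
      exact hG.antisymm (by simpa using hy') (one_groupLeL_iff.2 hy)
    | succ n ih =>
      refine (Set.Finite.image2 (· * ·) hfin ih).subset ?_
      rintro y ⟨hy, hy'⟩
      obtain ⟨d, hdy, hdΔ, hd⟩ := hG.exists_meet y Δ
      refine ⟨d, mem_simples_iff.2 ⟨one_groupLeL_iff.1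
        (hd 1 (one_groupLeL_iff.2 hy) (one_groupLeL_iff.2 Δ.2)), hdΔ⟩, d⁻¹ * y,
        ⟨groupLeL_iff.1 hdy, ?_⟩, by simp⟩
      rw [← groupLeL_mul_left_iff (a := d), mul_inv_cancel_left, ← hG.mul_zpow_le_iff (-n),
        mul_assoc, ← zpow_add, add_neg_cancel, zpow_zero, mul_one]
      refine hd _ ?_ ?_
      · simpa using groupLeL_mul_left_iff (a := y).2 (zpow_le_zpow (Δ := Δ) (a := -n) (b := 0)
          (by omega))
      · have := (hG.mul_zpow_le_iff (-n)).2 hy'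
        rw [← zpow_add] at this
        simpa using this
  refine ((hpos (m + m)).image fun y => (Δ : G) ^ (-m : ℤ) * y).subset ?_
  rintro x ⟨h1, h2⟩
  refine ⟨(Δ : G) ^ (m : ℤ) * x, ⟨?_, ?_⟩, by simp⟩
  · simpa using groupLeL_iff.1 h1
  · push_cast
    rw [zpow_add]
    exact groupLeL_mul_left_iff.2 h2

/-- The prefixes of a longest atomic expression of `Δ` are `‖Δ‖ + 1` simple elements with distinct
norms. This gives a bound on the exponents that can be read off the input. -/
theorem natNorm_delta_lt_card {k : ℕ} {s : Fin k → G} (hs : Set.range s = simples P Δ) :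
    natNorm Δ < k := by
  have hat := hG.garsideMonoid.atomic
  obtain ⟨l, hl, hlen⟩ := hat.exists_length_eq_natNorm Δ
  have h0 : ∀ l : List P, (∀ x ∈ l, IsMulAtom x) → l.length ≤ natNorm l.prod := fun l hl =>
    hat.length_le_natNorm ⟨hl, rfl⟩
  have h1 : ∀ j : Fin (natNorm Δ + 1), natNorm (l.take j).prod = j := by
    intro j
    have h2 := h0 (l.take j) fun x hx => hl.1 x (List.mem_of_mem_take hx)
    have h3 := h0 (l.drop j) fun x hx => hl.1 x (List.mem_of_mem_drop hx)
    have h4 := hat.natNorm_add_le (l.take j).prod (l.drop j).prod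
    rw [← List.prod_append, List.take_append_drop, hl.2] at h4
    rw [List.length_take] at h2
    rw [List.length_drop] at h3
    have := j.2
    omega
  have h5 : ∀ j : Fin (natNorm Δ + 1), ∃ i : Fin k, s i = ((l.take j).prod : P) := by
    intro j
    have : (((l.take j).prod : P) : G) ∈ Set.range s := by
      rw [hs]
      exact ⟨_, ⟨(l.drop j).prod, by rw [← List.prod_append, List.take_append_drop, hl.2]⟩, rfl⟩
    exact this
  choose f hf using h5
  have hinj : Function.Injective f := by
    intro i j hij
    have h6 : (((l.take i).prod : P) : G) = ((l.take j).prod : P) := by rw [← hf, ← hf, hij]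
    have h7 := h1 i
    rw [Subtype.ext h6, h1 j] at h7
    exact Fin.ext h7.symm
  simpa using Fintype.card_le_of_injective f hinj

theorem exists_mem_conjList {m : ℕ} {x : G} {U : Set G} (hU : IsConjList Δ m x U) {w : G}
    (hw : InRange Δ m (w⁻¹ * x * w)) : ∃ u ∈ U, u⁻¹ * x * u = w⁻¹ * x * w := by
  refine hG.conj_mem_of_closed (S := (fun u => u⁻¹ * x * u) '' U) ?_ ?_ ?_ (x := x) ?_ hw
  · rintro _ ⟨u, hu, rfl⟩
    exact hU.inRange u hu
  · rintro _ ⟨u, hu, rfl⟩ a ha hr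
    have h1 : (u * a)⁻¹ * x * (u * a) = a⁻¹ * (u⁻¹ * x * u) * a := by group
    obtain ⟨v, hv, hv'⟩ := hU.closed u hu a (Or.inl ha) (by rwa [h1])
    exact ⟨v, hv, hv'.trans h1⟩
  · rintro _ ⟨u, hu, rfl⟩ a ha hr
    have h1 : (u * a⁻¹)⁻¹ * x * (u * a⁻¹) = a * (u⁻¹ * x * u) * a⁻¹ := by group
    obtain ⟨v, hv, hv'⟩ := hU.closed u hu a⁻¹ (Or.inr (by rwa [inv_inv])) (by rwa [h1])
    exact ⟨v, hv, hv'.trans h1⟩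
  · exact ⟨1, hU.one_mem, by simp⟩

theorem isConj_iff_of_conjList {m : ℕ} {x g : G} {U : Set G} (hU : IsConjList Δ m x U)
    (hg : InRange Δ m g) : IsConj g x ↔ ∃ u ∈ U, u⁻¹ * x * u = g := by
  constructor
  · intro h
    obtain ⟨c, rfl⟩ := isConj_iff.1 h
    obtain ⟨u, hu, h1⟩ := hG.exists_mem_conjList hU (w := c) (by simpa [mul_assoc] using hg)
    exact ⟨u, hu, h1.trans (by simp [mul_assoc])⟩
  · rintro ⟨u, -, rfl⟩
    exact isConj_iff.2 ⟨u, by simp [mul_assoc]⟩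

/-- A larger infimum, if attained in the conjugacy class, is attained by a conjugate whose supremum
is still at most `m`, hence by one in the list. The index `r` encodes the exponents `r - m` from
`-m` to `m`. -/
theorem infMax_iff_of_conjList {m : ℕ} {x : G} {U : Set G} (hU : IsConjList Δ m x U) :
    InfMax Δ x ↔ ∀ u ∈ U, ∀ r < 2 * m + 1,
      GroupLeL P ((Δ : G) ^ ((r : ℤ) - m)) (u⁻¹ * x * u) →
        GroupLeL P ((Δ : G) ^ ((r : ℤ) - m)) x := by
  constructor
  · intro h u _ r _ hr
    exact h _ ⟨u, hr⟩
  · intro h z hz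
    by_cases hΔ : (Δ : G) = 1
    · have := hG.subsingleton_of_delta_eq_one hΔ
      rw [Subsingleton.elim x ((Δ : G) ^ z)]
      exact GroupLeL.refl _
    have hx : InRange Δ m x := by simpa using hU.inRange 1 hU.one_mem
    rcases le_or_gt z (-m) with hle | hlt
    · exact (zpow_le_zpow hle).trans hx.1
    have hzm := hG.le_of_conjGE hΔ hz hx.2
    obtain ⟨v, hv1, hv2⟩ := hG.exists_conj_between hx.2 hz
    obtain ⟨u, hu, huv⟩ := hG.exists_mem_conjList hU (w := v)
      ⟨(zpow_le_zpow hlt.le).trans hv1, hv2⟩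
    obtain ⟨r, hr⟩ := Int.eq_ofNat_of_zero_le (a := z + m) (by omega)
    have h1 := h u hu r (by omega)
    rw [huv, show (r : ℤ) - m = z by omega] at h1
    exact h1 hv1

end IsGarsideGroup

end Conjugacy

/-! ### The algorithm on words, and the certificates it searches for. -/

section Algorithm

/-- Left divisibility of simple elements, read off the multiplication table. -/
def TableLe (T : List (ℕ × ℕ × ℕ)) (i l : ℕ) : Prop := ∃ t ∈ T, t.1 = i ∧ t.2.2 = l

/-- Least common right multiples of simple elements, read off the multiplication table. -/
def TableLcm (T : List (ℕ × ℕ × ℕ)) (i j l : ℕ) : Prop :=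
  TableLe T i l ∧ TableLe T j l ∧
    ∀ t ∈ T, TableLe T i t.2.2 ∧ TableLe T j t.2.2 → TableLe T l t.2.2

open Classical in
/-- The index of the least common right multiple. -/
noncomputable def lcmIndex (T : List (ℕ × ℕ × ℕ)) (i j : ℕ) : ℕ :=
  (T.filter fun t => TableLcm T i j t.2.2).headI.2.2

open Classical in
/-- The index of the quotient of two simple elements. -/
noncomputable def quotIndex (T : List (ℕ × ℕ × ℕ)) (i l : ℕ) : ℕ :=
  (T.filter fun t => t.1 = i ∧ t.2.2 = l).headI.2.1

/-- One step of the left division of a positive word by a simple element: the state consists of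
the current remainder and the part of the quotient found so far. -/
noncomputable def divStep (T : List (ℕ × ℕ × ℕ)) (st : ℕ × List ℕ) (a : ℕ) : ℕ × List ℕ :=
  (quotIndex T a (lcmIndex T a st.1), st.2 ++ [quotIndex T st.1 (lcmIndex T a st.1)])

open Classical in
/-- Left division of a positive word by a simple element. -/
noncomputable def leftDiv (T : List (ℕ × ℕ × ℕ)) (b : ℕ) (w : List ℕ) : Option (List ℕ) :=
  if (((w.foldl (divStep T) (b, [])).1, (w.foldl (divStep T) (b, [])).1,
      (w.foldl (divStep T) (b, [])).1) : ℕ × ℕ × ℕ) ∈ T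
  then some (w.foldl (divStep T) (b, [])).2 else none

/-- Left multiplication of a positive word by a signed letter, if the result is positive. -/
noncomputable def mulLetter (T : List (ℕ × ℕ × ℕ)) (x : ℕ × Bool) (o : Option (List ℕ)) :
    Option (List ℕ) :=
  o.bind fun w => bif x.2 then some (x.1 :: w) else leftDiv T x.1 w

/-- The test for positivity of a word `v` of length `n`: compute `Δ⁻ⁿvΔⁿ`. -/
def IsPosWord (c : GroupCode) (v : WordCode) : Prop :=
  ((v.map fun _ => (c.2.1, false)) ++ v).foldr (mulLetter c.2.2)
    (some (v.map fun _ => c.2.1)) ≠ none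

/-- The inverse of a word. -/
def wordInv (v : WordCode) : WordCode := (v.map fun x => (x.1, !x.2)).reverse

/-- The words `v` and `w` represent the same element. -/
def WordEq (c : GroupCode) (v w : WordCode) : Prop :=
  IsPosWord c (wordInv v ++ w) ∧ IsPosWord c (wordInv w ++ v)

/-- The word `u⁻¹xu`. -/
def wordConj (u x : WordCode) : WordCode := wordInv u ++ x ++ u

/-- The word for `Δ^n`, or for `Δ^(-n)`. -/
def deltaWord (c : GroupCode) (n : ℕ) (b : Bool) : WordCode :=
  (List.range n).map fun _ => (c.2.1, b)

/-- The word `v^(n+1)`. -/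
def wordPow (v : WordCode) (n : ℕ) : WordCode := n.rec v fun _ w => v ++ w

/-- The element lies between `Δ^(-m)` and `Δ^m`. -/
def WordInRange (c : GroupCode) (m : ℕ) (x : WordCode) : Prop :=
  IsPosWord c (deltaWord c m true ++ x) ∧ IsPosWord c (wordInv x ++ deltaWord c m true)

/-- All signed letters. -/
def letters (c : GroupCode) : WordCode :=
  (List.range c.1).flatMap fun i => [(i, true), (i, false)]

/-- The powers of an element and of its inverse that have to be tested. -/
def testWords (c : GroupCode) (h : WordCode) : List WordCode :=
  (List.range c.1).flatMap fun n => [wordPow h n, wordInv (wordPow h n)]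

/-- Inputs of the algorithm. -/
abbrev InputCode : Type := GroupCode × WordCode × WordCode

/-- Certificates: a range, and a list of pairs of an element and a conjugating element. -/
abbrev CertCode : Type := ℕ × List (WordCode × WordCode)

/-- The certificate lists all the conjugates in the given range of the words to be tested. -/
def IsCert (I : InputCode) (K : CertCode) : Prop :=
  WordInRange I.1 K.1 I.2.1 ∧
  (∀ x ∈ testWords I.1 I.2.2, (x, []) ∈ K.2) ∧
  ∀ p ∈ K.2, p.1 ∈ testWords I.1 I.2.2 ∧ (∀ a ∈ p.2, a ∈ letters I.1) ∧
    WordInRange I.1 K.1 (wordConj p.2 p.1) ∧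
    ∀ a ∈ letters I.1, WordInRange I.1 K.1 (wordConj (p.2 ++ [a]) p.1) →
      ∃ q ∈ K.2, q.1 = p.1 ∧ WordEq I.1 (wordConj q.2 q.1) (wordConj (p.2 ++ [a]) p.1)

/-- The answer of the algorithm, given a certificate. -/
def CertAccepts (I : InputCode) (K : CertCode) : Prop :=
  (∃ p ∈ K.2, p.1 = I.2.2 ∧ WordEq I.1 (wordConj p.2 p.1) I.2.1) ∧
  ∀ p ∈ K.2, ∀ r ∈ List.range (2 * K.1 + 1),
    IsPosWord I.1 (deltaWord I.1 r false ++ deltaWord I.1 K.1 true ++ wordConj p.2 p.1) →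
      IsPosWord I.1 (deltaWord I.1 r false ++ deltaWord I.1 K.1 true ++ p.1)

end Algorithm

/-! ### Computability: checking a certificate is primitive recursive, and the search is partial
recursive. -/

section Primrec

theorem primrecPred_imp {α : Type*} [Primcodable α] {p q : α → Prop} (hp : PrimrecPred p)
    (hq : PrimrecPred q) : PrimrecPred fun a => p a → q a :=
  (hp.not.or hq).of_eq fun _ => imp_iff_not_or.symm

theorem primrecPred_forall_mem {α β : Type*} [Primcodable α] [Primcodable β] {f : α → List β}
    {p : α → β → Prop} (hf : Primrec f) (hp : PrimrecPred fun q : α × β => p q.1 q.2) :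
    PrimrecPred fun a => ∀ b ∈ f a, p a b :=
  (PrimrecRel.forall_mem_list (R := fun b a => p a b)
    (hp.comp (Primrec.pair Primrec.snd Primrec.fst))).comp hf Primrec.id

theorem primrecPred_exists_mem {α β : Type*} [Primcodable α] [Primcodable β] {f : α → List β}
    {p : α → β → Prop} (hf : Primrec f) (hp : PrimrecPred fun q : α × β => p q.1 q.2) :
    PrimrecPred fun a => ∃ b ∈ f a, p a b :=
  (PrimrecRel.exists_mem_list (R := fun b a => p a b)
    (hp.comp (Primrec.pair Primrec.snd Primrec.fst))).comp hf Primrec.id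

theorem primrecPred_mem_list {α β : Type*} [Primcodable α] [Primcodable β] {f : α → List β}
    {g : α → β} (hf : Primrec f) (hg : Primrec g) : PrimrecPred fun a => g a ∈ f a :=
  (primrecPred_exists_mem (p := fun a b => b = g a) hf
    (Primrec.eq.comp Primrec.snd (hg.comp Primrec.fst))).of_eq fun _ => by simp

theorem primrec_filter {α β : Type*} [Primcodable α] [Primcodable β] {f : α → List β}
    {p : α → β → Prop} [∀ a, DecidablePred (p a)] (hf : Primrec f)
    (hp : PrimrecPred fun q : α × β => p q.1 q.2) :
    Primrec fun a => (f a).filter fun b => p a b :=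
  (PrimrecRel.listFilter (R := fun b a => p a b)
    (hp.comp (Primrec.pair Primrec.snd Primrec.fst))).comp hf Primrec.id

open Primrec

theorem primrecPred_tableLe {α : Type*} [Primcodable α] {T : α → List (ℕ × ℕ × ℕ)} {i l : α → ℕ}
    (hT : Primrec T) (hi : Primrec i) (hl : Primrec l) :
    PrimrecPred fun a => TableLe (T a) (i a) (l a) :=
  primrecPred_exists_mem hT
    ((Primrec.eq.comp (fst.comp snd) (hi.comp fst)).and
      (Primrec.eq.comp (snd.comp (snd.comp snd)) (hl.comp fst)))

theorem primrecPred_tableLcm {α : Type*} [Primcodable α] {T : α → List (ℕ × ℕ × ℕ)}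
    {i j l : α → ℕ} (hT : Primrec T) (hi : Primrec i) (hj : Primrec j) (hl : Primrec l) :
    PrimrecPred fun a => TableLcm (T a) (i a) (j a) (l a) := by
  have h3 : Primrec fun q : α × ℕ × ℕ × ℕ => q.2.2.2 := snd.comp (snd.comp snd)
  refine (primrecPred_tableLe hT hi hl).and ((primrecPred_tableLe hT hj hl).and
    (primrecPred_forall_mem hT (primrecPred_imp (.and ?_ ?_) ?_)))
  · exact primrecPred_tableLe (hT.comp fst) (hi.comp fst) h3
  · exact primrecPred_tableLe (hT.comp fst) (hj.comp fst) h3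
  · exact primrecPred_tableLe (hT.comp fst) (hl.comp fst) h3

theorem primrec_lcmIndex {α : Type*} [Primcodable α] {T : α → List (ℕ × ℕ × ℕ)}
    {i j : α → ℕ} (hT : Primrec T) (hi : Primrec i) (hj : Primrec j) :
    Primrec fun a => lcmIndex (T a) (i a) (j a) := by
  classical
  refine snd.comp (snd.comp (list_headI.comp ?_))
  exact primrec_filter hT (primrecPred_tableLcm (hT.comp fst) (hi.comp fst) (hj.comp fst)
    (snd.comp (snd.comp snd)))

theorem primrec_quotIndex {α : Type*} [Primcodable α] {T : α → List (ℕ × ℕ × ℕ)}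
    {i l : α → ℕ} (hT : Primrec T) (hi : Primrec i) (hl : Primrec l) :
    Primrec fun a => quotIndex (T a) (i a) (l a) := by
  classical
  refine fst.comp (snd.comp (list_headI.comp ?_))
  exact primrec_filter hT ((Primrec.eq.comp (fst.comp snd) (hi.comp fst)).and
    (Primrec.eq.comp (snd.comp (snd.comp snd)) (hl.comp fst)))

theorem primrec_leftDiv {α : Type*} [Primcodable α] {T : α → List (ℕ × ℕ × ℕ)}
    {b : α → ℕ} {w : α → List ℕ} (hT : Primrec T) (hb : Primrec b) (hw : Primrec w) :
    Primrec fun a => leftDiv (T a) (b a) (w a) := by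
  classical
  have hf : Primrec fun a => (w a).foldl (divStep (T a)) (b a, []) := by
    refine list_foldl (h := fun a q => divStep (T a) q.1 q.2) hw (hb.pair (const [])) ?_
    have h1 : Primrec fun q : α × (ℕ × List ℕ) × ℕ => T q.1 := hT.comp fst
    have h2 : Primrec fun q : α × (ℕ × List ℕ) × ℕ => q.2.2 := snd.comp snd
    have h3 : Primrec fun q : α × (ℕ × List ℕ) × ℕ => q.2.1.1 := fst.comp (fst.comp snd)
    have h4 : Primrec fun q : α × (ℕ × List ℕ) × ℕ => q.2.1.2 := snd.comp (fst.comp snd)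
    have h5 := primrec_lcmIndex h1 h2 h3
    exact (primrec_quotIndex h1 h2 h5).pair (list_concat.comp h4 (primrec_quotIndex h1 h3 h5))
  have h1 := fst.comp hf
  exact Primrec.ite (primrecPred_mem_list hT (h1.pair (h1.pair h1)))
    (option_some.comp (snd.comp hf)) (const none)

theorem primrecPred_isPosWord {α : Type*} [Primcodable α] {c : α → GroupCode} {v : α → WordCode}
    (hc : Primrec c) (hv : Primrec v) : PrimrecPred fun a => IsPosWord (c a) (v a) := by
  have hd : Primrec fun a => (c a).2.1 := fst.comp (snd.comp hc)
  have hT : Primrec fun a => (c a).2.2 := snd.comp (snd.comp hc)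
  refine (Primrec.eq.comp (list_foldr (h := fun a q => mulLetter (c a).2.2 q.1 q.2)
    (list_append.comp (list_map hv ?_) hv) (option_some.comp (list_map hv ?_)) ?_)
    (const none)).not
  · exact (hd.comp fst).pair (const false)
  · exact hd.comp fst
  · refine option_bind (snd.comp snd) ?_
    have h1 : Primrec fun q : (α × (ℕ × Bool) × Option (List ℕ)) × List ℕ => q.1.2.1 :=
      fst.comp (snd.comp fst)
    exact Primrec.cond (snd.comp h1) (option_some.comp (list_cons.comp (fst.comp h1) snd))
      (primrec_leftDiv (hT.comp (fst.comp fst)) (fst.comp h1) snd)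

theorem primrec_wordInv : Primrec wordInv :=
  list_reverse.comp (list_map Primrec.id
    ((fst.comp snd).pair (Primrec.not.comp (snd.comp snd))).to₂)

theorem primrecPred_wordEq {α : Type*} [Primcodable α] {c : α → GroupCode} {v w : α → WordCode}
    (hc : Primrec c) (hv : Primrec v) (hw : Primrec w) :
    PrimrecPred fun a => WordEq (c a) (v a) (w a) :=
  (primrecPred_isPosWord hc (list_append.comp (primrec_wordInv.comp hv) hw)).and
    (primrecPred_isPosWord hc (list_append.comp (primrec_wordInv.comp hw) hv))

theorem primrec_wordConj {α : Type*} [Primcodable α] {u x : α → WordCode}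
    (hu : Primrec u) (hx : Primrec x) : Primrec fun a => wordConj (u a) (x a) :=
  list_append.comp (list_append.comp (primrec_wordInv.comp hu) hx) hu

theorem primrec_deltaWord {α : Type*} [Primcodable α] {c : α → GroupCode} {n : α → ℕ}
    (hc : Primrec c) (hn : Primrec n) (b : Bool) : Primrec fun a => deltaWord (c a) (n a) b :=
  list_map (list_range.comp hn) (((fst.comp (snd.comp hc)).comp fst).pair (const b))

theorem primrec_wordPow {α : Type*} [Primcodable α] {v : α → WordCode} {n : α → ℕ}
    (hv : Primrec v) (hn : Primrec n) : Primrec fun a => wordPow (v a) (n a) :=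
  nat_rec' (h := fun a q => v a ++ q.2) hn hv
    (list_append.comp (hv.comp fst) (snd.comp snd))

theorem primrecPred_wordInRange {α : Type*} [Primcodable α] {c : α → GroupCode} {m : α → ℕ}
    {x : α → WordCode} (hc : Primrec c) (hm : Primrec m) (hx : Primrec x) :
    PrimrecPred fun a => WordInRange (c a) (m a) (x a) :=
  (primrecPred_isPosWord hc (list_append.comp (primrec_deltaWord hc hm true) hx)).and
    (primrecPred_isPosWord hc
      (list_append.comp (primrec_wordInv.comp hx) (primrec_deltaWord hc hm true)))

theorem primrec_letters {α : Type*} [Primcodable α] {c : α → GroupCode} (hc : Primrec c) :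
    Primrec fun a => letters (c a) :=
  list_flatMap (list_range.comp (fst.comp hc))
    (list_cons.comp (snd.pair (const true)) (list_cons.comp (snd.pair (const false)) (const [])))

theorem primrec_testWords {α : Type*} [Primcodable α] {c : α → GroupCode} {h : α → WordCode}
    (hc : Primrec c) (hh : Primrec h) : Primrec fun a => testWords (c a) (h a) := by
  have h1 : Primrec fun q : α × ℕ => wordPow (h q.1) q.2 := primrec_wordPow (hh.comp fst) snd
  exact list_flatMap (list_range.comp (fst.comp hc))
    (list_cons.comp h1 (list_cons.comp (primrec_wordInv.comp h1) (const [])))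

theorem primrecPred_isCert : PrimrecPred fun q : InputCode × CertCode => IsCert q.1 q.2 := by
  have hc : Primrec fun q : InputCode × CertCode => q.1.1 := fst.comp fst
  have hg : Primrec fun q : InputCode × CertCode => q.1.2.1 := fst.comp (snd.comp fst)
  have hh : Primrec fun q : InputCode × CertCode => q.1.2.2 := snd.comp (snd.comp fst)
  have hm : Primrec fun q : InputCode × CertCode => q.2.1 := fst.comp snd
  have hL : Primrec fun q : InputCode × CertCode => q.2.2 := snd.comp snd
  have ht := primrec_testWords hc hh
  have hl := primrec_letters hc
  refine (primrecPred_wordInRange hc hm hg).and (.and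
    (primrecPred_forall_mem ht (primrecPred_mem_list (hL.comp fst) (snd.pair (const []))))
    (primrecPred_forall_mem hL ?_))
  have hx : Primrec fun q : (InputCode × CertCode) × WordCode × WordCode => q.2.1 := fst.comp snd
  have hu : Primrec fun q : (InputCode × CertCode) × WordCode × WordCode => q.2.2 := snd.comp snd
  refine (primrecPred_mem_list (ht.comp fst) hx).and (.and
    (primrecPred_forall_mem hu (primrecPred_mem_list (hl.comp (fst.comp fst)) snd)) (.and
    (primrecPred_wordInRange (hc.comp fst) (hm.comp fst) (primrec_wordConj hu hx))
    (primrecPred_forall_mem (hl.comp fst) ?_)))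
  have hw : Primrec fun q : ((InputCode × CertCode) × WordCode × WordCode) × ℕ × Bool =>
      wordConj (q.1.2.2 ++ [q.2]) q.1.2.1 :=
    primrec_wordConj (list_concat.comp (hu.comp fst) snd) (hx.comp fst)
  refine primrecPred_imp (primrecPred_wordInRange (hc.comp (fst.comp fst))
    (hm.comp (fst.comp fst)) hw) (primrecPred_exists_mem (hL.comp (fst.comp fst)) ?_)
  exact (Primrec.eq.comp (fst.comp snd) (hx.comp (fst.comp fst))).and
    (primrecPred_wordEq (hc.comp (fst.comp (fst.comp fst)))
      (primrec_wordConj (snd.comp snd) (fst.comp snd)) (hw.comp fst))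

theorem primrecPred_certAccepts :
    PrimrecPred fun q : InputCode × CertCode => CertAccepts q.1 q.2 := by
  have hc : Primrec fun q : InputCode × CertCode => q.1.1 := fst.comp fst
  have hg : Primrec fun q : InputCode × CertCode => q.1.2.1 := fst.comp (snd.comp fst)
  have hh : Primrec fun q : InputCode × CertCode => q.1.2.2 := snd.comp (snd.comp fst)
  have hm : Primrec fun q : InputCode × CertCode => q.2.1 := fst.comp snd
  have hL : Primrec fun q : InputCode × CertCode => q.2.2 := snd.comp snd
  have hx : Primrec fun q : (InputCode × CertCode) × WordCode × WordCode => q.2.1 := fst.comp snd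
  have hu : Primrec fun q : (InputCode × CertCode) × WordCode × WordCode => q.2.2 := snd.comp snd
  have hw := primrec_wordConj hu hx
  refine (primrecPred_exists_mem hL ((Primrec.eq.comp hx (hh.comp fst)).and
    (primrecPred_wordEq (hc.comp fst) hw (hg.comp fst)))).and
    (primrecPred_forall_mem hL (primrecPred_forall_mem ?_ (primrecPred_imp ?_ ?_)))
  · exact list_range.comp (succ.comp (nat_mul.comp (const 2) (hm.comp fst)))
  · exact primrecPred_isPosWord (hc.comp (fst.comp fst)) (list_append.comp (list_append.comp
      (primrec_deltaWord (hc.comp (fst.comp fst)) snd false)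
      (primrec_deltaWord (hc.comp (fst.comp fst)) (hm.comp (fst.comp fst)) true)) (hw.comp fst))
  · exact primrecPred_isPosWord (hc.comp (fst.comp fst)) (list_append.comp (list_append.comp
      (primrec_deltaWord (hc.comp (fst.comp fst)) snd false)
      (primrec_deltaWord (hc.comp (fst.comp fst)) (hm.comp (fst.comp fst)) true)) (hx.comp fst))

open Classical in
/-- The answer given by a certificate, if it is valid. -/
noncomputable def certAnswer (q : InputCode × CertCode) : Option Bool :=
  if IsCert q.1 q.2 then some (decide (CertAccepts q.1 q.2)) else none

theorem primrec_certAnswer : Primrec certAnswer := by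
  classical
  exact Primrec.ite primrecPred_isCert (option_some.comp primrecPred_certAccepts.decide)
    (const none)

/-- The algorithm: search for a certificate, then give the answer. -/
noncomputable def decideStable (I : InputCode) : Part Bool :=
  Nat.rfindOpt fun n => (Encodable.decode (α := CertCode) n).bind fun K => certAnswer (I, K)

theorem partrec_decideStable : Partrec decideStable := by
  have h : Primrec₂ fun (I : InputCode) (n : ℕ) =>
      (Encodable.decode (α := CertCode) n).bind fun K => certAnswer (I, K) :=
    Primrec.option_bind (Primrec.decode.comp snd)
      (primrec_certAnswer.comp ((fst.comp fst).pair snd)).to₂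
  exact Partrec.rfindOpt h.to_comp

end Primrec

/-! ### Correctness of the algorithm on codes of Garside groups. -/

section Correctness

variable {G : Type*} [Group G] {P : Submonoid G} {Δ : P} {k : ℕ} {s : Fin k → G} {c : GroupCode}

/-- The simple element with a given index. -/
def letterVal (s : Fin k → G) (i : ℕ) : G := if h : i < k then s ⟨i, h⟩ else 1

/-- The element represented by a positive word. -/
def posVal (s : Fin k → G) (w : List ℕ) : G := (w.map (letterVal s)).prod

/-- The element represented by a signed word. -/
def codeVal (s : Fin k → G) (v : WordCode) : G :=
  (v.map fun x => if x.2 then letterVal s x.1 else (letterVal s x.1)⁻¹).prod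

/-- All the letters of the word are indices of simple elements. -/
def IsValid (k : ℕ) (v : WordCode) : Prop := ∀ x ∈ v, x.1 < k

@[simp] theorem posVal_cons (a : ℕ) (w : List ℕ) :
    posVal s (a :: w) = letterVal s a * posVal s w := by simp [posVal]

@[simp] theorem posVal_nil : posVal s [] = 1 := by simp [posVal]

@[simp] theorem codeVal_nil : codeVal s [] = 1 := by simp [codeVal]

@[simp] theorem codeVal_append (v w : WordCode) :
    codeVal s (v ++ w) = codeVal s v * codeVal s w := by simp [codeVal]

theorem codeVal_cons (x : ℕ × Bool) (w : WordCode) :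
    codeVal s (x :: w) =
      (if x.2 then letterVal s x.1 else (letterVal s x.1)⁻¹) * codeVal s w := by simp [codeVal]

@[simp] theorem codeVal_wordInv (v : WordCode) : codeVal s (wordInv v) = (codeVal s v)⁻¹ := by
  induction v with
  | nil => simp [wordInv]
  | cons x v ih =>
    have : wordInv (x :: v) = wordInv v ++ [(x.1, !x.2)] := by simp [wordInv]
    rw [this, codeVal_append, ih, codeVal_cons, codeVal_cons]
    cases x.2 <;> simp

@[simp] theorem codeVal_wordConj (u x : WordCode) :
    codeVal s (wordConj u x) = (codeVal s u)⁻¹ * codeVal s x * codeVal s u := by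
  simp [wordConj, mul_assoc]

theorem codeVal_wordPow (v : WordCode) (n : ℕ) :
    codeVal s (wordPow v n) = codeVal s v ^ (n + 1) := by
  induction n with
  | zero => simp [wordPow]
  | succ n ih =>
    have : wordPow v (n + 1) = v ++ wordPow v n := rfl
    rw [this, codeVal_append, ih, ← pow_succ']

theorem codeVal_wordCode (v : List (Fin k × Bool)) : codeVal s (wordCode v) = wordValue s v := by
  simp [codeVal, wordCode, wordValue, letterVal, Function.comp_def]

theorem isValid_wordCode (v : List (Fin k × Bool)) : IsValid k (wordCode v) := by
  intro x hx
  obtain ⟨y, -, rfl⟩ := List.mem_map.1 hx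
  exact y.1.2

theorem IsValid.append {v w : WordCode} (hv : IsValid k v) (hw : IsValid k w) :
    IsValid k (v ++ w) := by
  intro x hx
  rcases List.mem_append.1 hx with h | h
  · exact hv x h
  · exact hw x h

theorem IsValid.wordInv {v : WordCode} (hv : IsValid k v) : IsValid k (wordInv v) := by
  intro x hx
  obtain ⟨y, hy, rfl⟩ := List.mem_map.1 (List.mem_reverse.1 hx)
  exact hv y hy

theorem IsValid.wordConj {u v : WordCode} (hu : IsValid k u) (hv : IsValid k v) :
    IsValid k (wordConj u v) := (hu.wordInv.append hv).append hu

theorem IsValid.wordPow {v : WordCode} (hv : IsValid k v) (n : ℕ) : IsValid k (wordPow v n) := by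
  induction n with
  | zero => exact hv
  | succ n ih => exact hv.append ih

theorem mem_letters_iff {a : ℕ × Bool} : a ∈ letters c ↔ a.1 < c.1 := by
  obtain ⟨i, b⟩ := a
  cases b <;> simp [letters]

theorem mem_testWords_iff {h x : WordCode} : x ∈ testWords c h ↔
    ∃ n < c.1, x = wordPow h n ∨ x = wordInv (wordPow h n) := by
  simp [testWords]

theorem IsValid.of_mem_testWords {h x : WordCode} (hh : IsValid k h) (hx : x ∈ testWords c h) :
    IsValid k x := by
  obtain ⟨n, -, rfl | rfl⟩ := mem_testWords_iff.1 hx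
  · exact hh.wordPow n
  · exact (hh.wordPow n).wordInv

theorem headI_filter {α : Type*} [Inhabited α] {p : α → Prop} [DecidablePred p] {l : List α}
    (h : ∃ a ∈ l, p a) : (l.filter p).headI ∈ l ∧ p (l.filter p).headI := by
  obtain ⟨a, ha, hp⟩ := h
  have hmem : a ∈ l.filter p := by simp [ha, hp]
  cases hl : l.filter p with
  | nil => simp [hl] at hmem
  | cons b l' =>
    have : b ∈ l.filter p := by simp [hl]
    simpa using this

namespace IsCode

variable (hG : IsGarsideGroup P Δ) (hc : IsCode P Δ s c)
include hc

theorem letterVal_mem {i : ℕ} (hi : i < k) : letterVal s i ∈ simples P Δ := by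
  rw [← hc.range_eq, letterVal, dif_pos hi]
  exact ⟨_, rfl⟩

theorem exists_letterVal_eq {a : G} (ha : a ∈ simples P Δ) : ∃ i < k, letterVal s i = a := by
  rw [← hc.range_eq] at ha
  obtain ⟨i, rfl⟩ := ha
  exact ⟨i, i.2, by simp [letterVal]⟩

theorem mem_table {i j l : ℕ} : (i, j, l) ∈ c.2.2 ↔
    i < k ∧ j < k ∧ l < k ∧ letterVal s i * letterVal s j = letterVal s l := by
  rw [hc.mem_table_iff]
  constructor
  · rintro ⟨a, b, e, rfl, rfl, rfl, h⟩
    exact ⟨a.2, b.2, e.2, by simpa [letterVal] using h⟩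
  · rintro ⟨hi, hj, hl, h⟩
    exact ⟨⟨i, hi⟩, ⟨j, hj⟩, ⟨l, hl⟩, rfl, rfl, rfl, by simpa [letterVal, hi, hj, hl] using h⟩

theorem delta_lt : c.2.1 < k := by
  obtain ⟨d, h1, -⟩ := hc.delta_eq
  rw [h1]
  exact d.2

theorem letterVal_delta : letterVal s c.2.1 = Δ := by
  obtain ⟨d, h1, h2⟩ := hc.delta_eq
  rw [h1, ← h2]
  simp [letterVal]

include hG

omit hc in
theorem inv_mul_mem_simples {a b : G} (ha : a ∈ simples P Δ) (hb : b ∈ simples P Δ)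
    (hab : GroupLeL P a b) : a⁻¹ * b ∈ simples P Δ := by
  rw [hG.mem_simples_iff_right] at *
  refine ⟨groupLeL_iff.1 hab, ?_⟩
  have := P.mul_mem hb.2 ha.1
  simpa [mul_assoc] using this

theorem tableLe_iff {i l : ℕ} : TableLe c.2.2 i l ↔
    i < k ∧ l < k ∧ GroupLeL P (letterVal s i) (letterVal s l) := by
  constructor
  · rintro ⟨⟨i, j, l⟩, ht, rfl, rfl⟩
    obtain ⟨hi, hj, hl, h⟩ := hc.mem_table.1 ht
    exact ⟨hi, hl, _, (IsGarsideGroup.mem_simples_iff.1 (hc.letterVal_mem hj)).1, h⟩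
  · rintro ⟨hi, hl, h⟩
    obtain ⟨j, hj, h1⟩ := hc.exists_letterVal_eq
      (inv_mul_mem_simples hG (hc.letterVal_mem hi) (hc.letterVal_mem hl) h)
    exact ⟨(i, j, l), hc.mem_table.2 ⟨hi, hj, hl, by rw [h1]; group⟩, rfl, rfl⟩

omit hG in
theorem quotIndex_spec {i l : ℕ} (h : TableLe c.2.2 i l) : quotIndex c.2.2 i l < k ∧
    letterVal s i * letterVal s (quotIndex c.2.2 i l) = letterVal s l := by
  classical
  obtain ⟨h1, h2, h3⟩ := headI_filter (l := c.2.2)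
    (p := fun t : ℕ × ℕ × ℕ => t.1 = i ∧ t.2.2 = l) h
  have h5 : quotIndex c.2.2 i l =
      (c.2.2.filter fun t => t.1 = i ∧ t.2.2 = l).headI.2.1 := by
    unfold quotIndex
    congr!
  rw [h5]
  generalize (c.2.2.filter fun t => t.1 = i ∧ t.2.2 = l).headI = t at h1 h2 h3 ⊢
  have h4 := hc.mem_table.1 h1
  rw [h2, h3] at h4
  exact ⟨h4.2.1, h4.2.2.2⟩

/-- The join of two simple elements lies below `Δ`, so it is simple and occurs in the table. Being
least among the simple elements, the entry found is also least in the whole group. -/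
theorem lcmIndex_spec {i j : ℕ} (hi : i < k) (hj : j < k) :
    TableLe c.2.2 i (lcmIndex c.2.2 i j) ∧ TableLe c.2.2 j (lcmIndex c.2.2 i j) ∧
    ∀ z, GroupLeL P (letterVal s i) z → GroupLeL P (letterVal s j) z →
      GroupLeL P (letterVal s (lcmIndex c.2.2 i j)) z := by
  classical
  obtain ⟨d, h1, h2, h3⟩ := hG.exists_join (letterVal s i) (letterVal s j)
  have hsi := IsGarsideGroup.mem_simples_iff.1 (hc.letterVal_mem hi)
  have hsj := IsGarsideGroup.mem_simples_iff.1 (hc.letterVal_mem hj)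
  have hd : d ∈ simples P Δ := IsGarsideGroup.mem_simples_iff.2
    ⟨one_groupLeL_iff.1 ((one_groupLeL_iff.2 hsi.1).trans h1), h3 _ hsi.2 hsj.2⟩
  obtain ⟨l, hl, rfl⟩ := hc.exists_letterVal_eq hd
  have hle : TableLe c.2.2 i l := (hc.tableLe_iff hG).2 ⟨hi, hl, h1⟩
  have hle' : TableLe c.2.2 j l := (hc.tableLe_iff hG).2 ⟨hj, hl, h2⟩
  have hlcm : TableLcm c.2.2 i j l := by
    refine ⟨hle, hle', fun t _ ht => ?_⟩
    rw [hc.tableLe_iff hG, hc.tableLe_iff hG] at ht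
    exact (hc.tableLe_iff hG).2 ⟨hl, ht.1.2.1, h3 _ ht.1.2.2 ht.2.2.2⟩
  have hex : ∃ t ∈ c.2.2, TableLcm c.2.2 i j t.2.2 := by
    obtain ⟨t, ht, -, rfl⟩ := hle
    exact ⟨t, ht, hlcm⟩
  have h4 := headI_filter hex
  have h5 : lcmIndex c.2.2 i j =
      (c.2.2.filter fun t => TableLcm c.2.2 i j t.2.2).headI.2.2 := by
    unfold lcmIndex
    congr!
  rw [← h5] at h4
  obtain ⟨-, h6, h7, h8⟩ := h4
  refine ⟨h6, h7, fun z hzi hzj => ?_⟩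
  obtain ⟨t, ht, -, rfl⟩ := id hle
  exact (((hc.tableLe_iff hG).1 (h8 t ht ⟨hle, hle'⟩)).2.2).trans (h3 z hzi hzj)

/-- For a first letter `a`, the element `b` divides `aw` exactly if the join of `a` and `b` does,
that is, if `a⁻¹(a ∨ b)` divides `w`. This complement is the new remainder, and `b⁻¹(a ∨ b)` is the
next letter of the quotient. -/
theorem foldl_divStep_spec (w : List ℕ) (hw : ∀ a ∈ w, a < k) (b : ℕ) (hb : b < k)
    (acc : List ℕ) : ∃ r out, w.foldl (divStep c.2.2) (b, acc) = (r, acc ++ out) ∧ r < k ∧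
      (∀ a ∈ out, a < k) ∧ letterVal s b * posVal s out = posVal s w * letterVal s r ∧
      (GroupLeL P (letterVal s b) (posVal s w) ↔ letterVal s r = 1) := by
  suffices H : ∃ r out, w.foldl (divStep c.2.2) (b, acc) = (r, acc ++ out) ∧ r < k ∧
      (∀ a ∈ out, a < k) ∧ letterVal s b * posVal s out = posVal s w * letterVal s r ∧
      (GroupLeL P (letterVal s b) (posVal s w) ↔ GroupLeL P (letterVal s r) 1) by
    obtain ⟨r, out, h1, h2, h3, h4, h5⟩ := H
    refine ⟨r, out, h1, h2, h3, h4, h5.trans ⟨fun h => ?_, fun h => h ▸ GroupLeL.refl _⟩⟩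
    exact hG.antisymm h (one_groupLeL_iff.2
      (IsGarsideGroup.mem_simples_iff.1 (hc.letterVal_mem h2)).1)
  induction w generalizing b acc with
  | nil => exact ⟨b, [], by simp, hb, by simp, by simp, by simp⟩
  | cons a w ih =>
    have ha : a < k := hw a (by simp)
    have hw' : ∀ a ∈ w, a < k := fun x hx => hw x (by simp [hx])
    obtain ⟨h1, h2, h3⟩ := hc.lcmIndex_spec hG ha hb
    obtain ⟨hq, hq'⟩ := hc.quotIndex_spec h1
    obtain ⟨hr, hr'⟩ := hc.quotIndex_spec h2
    obtain ⟨r, out, h4, h5, h6, h7, h8⟩ := ih hw' _ hq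
      (acc ++ [quotIndex c.2.2 b (lcmIndex c.2.2 a b)])
    refine ⟨r, quotIndex c.2.2 b (lcmIndex c.2.2 a b) :: out, ?_, h5, ?_, ?_, ?_⟩
    · rw [List.foldl_cons, divStep, h4]
      simp
    · rintro x hx
      rcases List.mem_cons.1 hx with rfl | hx
      · exact hr
      · exact h6 x hx
    · rw [posVal_cons, posVal_cons, ← mul_assoc, hr', ← hq', mul_assoc, h7, mul_assoc]
    · rw [← h8, posVal_cons, ← groupLeL_mul_left_iff (a := letterVal s a)
        (g := letterVal s (quotIndex _ _ _)), hq']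
      have hpos : posVal s w ∈ P := P.list_prod_mem (by
        intro y hy
        obtain ⟨x, hx, rfl⟩ := List.mem_map.1 hy
        exact (IsGarsideGroup.mem_simples_iff.1 (hc.letterVal_mem (hw' x hx))).1)
      refine ⟨fun h => h3 _ ⟨_, hpos, rfl⟩ h, fun h => ?_⟩
      exact (((hc.tableLe_iff hG).1 h2).2.2).trans h

theorem leftDiv_spec {w : List ℕ} (hw : ∀ a ∈ w, a < k) {b : ℕ} (hb : b < k) :
    (GroupLeL P (letterVal s b) (posVal s w) ∧ ∃ out, leftDiv c.2.2 b w = some out ∧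
      (∀ a ∈ out, a < k) ∧ letterVal s b * posVal s out = posVal s w) ∨
    (¬ GroupLeL P (letterVal s b) (posVal s w) ∧ leftDiv c.2.2 b w = none) := by
  classical
  obtain ⟨r, out, h1, h2, h3, h4, h5⟩ := hc.foldl_divStep_spec hG w hw b hb []
  -- The table contains `(r, r, r)` exactly if the simple element is idempotent, which in a group
  -- means equal to `1`.
  have h6 : (r, r, r) ∈ c.2.2 ↔ letterVal s r = 1 := by
    rw [hc.mem_table]
    simp [h2]
  rw [List.nil_append] at h1
  have h7 : leftDiv c.2.2 b w = if letterVal s r = 1 then some out else none := by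
    unfold leftDiv
    rw [h1]
    simp only [h6]
  rw [h7]
  by_cases h : letterVal s r = 1
  · refine Or.inl ⟨h5.2 h, out, if_pos h, h3, ?_⟩
    rw [h4, h, mul_one]
  · exact Or.inr ⟨fun h' => h (h5.1 h'), if_neg h⟩

theorem neg_length_le_codeVal {v : WordCode} (hv : IsValid k v) :
    GroupLeL P ((Δ : G) ^ (-v.length : ℤ)) (codeVal s v) := by
  induction v with
  | nil => simpa using GroupLeL.refl _
  | cons x v ih =>
    have h1 := ih fun y hy => hv y (by simp [hy])
    have hx := hc.letterVal_mem (hv x (by simp))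
    have hx' := IsGarsideGroup.mem_simples_iff.1 hx
    have h2 : GroupLeL P ((Δ : G) ^ (-1 : ℤ))
        (if x.2 then letterVal s x.1 else (letterVal s x.1)⁻¹) := by
      split
      · refine GroupLeL.trans ?_ (one_groupLeL_iff.2 hx'.1)
        simpa using IsGarsideGroup.zpow_le_zpow (Δ := Δ) (a := -1) (b := 0) (by omega)
      · rw [← hG.le_zpow_iff_inv, zpow_one]
        exact hx'.2
    have h3 := hG.zpow_add_le_mul h2 h1
    rw [codeVal_cons]
    convert h3 using 2
    rw [List.length_cons]
    push_cast
    ring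

/-- No division fails: before a letter is applied, the suffix already read has length less than `n`,
so its value times `Δⁿ` is at least `Δ` and is divisible by every simple element. -/
theorem foldr_mulLetter_spec {v : WordCode} (hv : IsValid k v) {y : List ℕ}
    (hy : ∀ a ∈ y, a < k) {n : ℕ} (hn : v.length ≤ n) (hval : posVal s y = (Δ : G) ^ (n : ℤ)) :
    ∃ out, v.foldr (mulLetter c.2.2) (some y) = some out ∧ (∀ a ∈ out, a < k) ∧
      posVal s out = codeVal s v * (Δ : G) ^ (n : ℤ) := by
  induction v with
  | nil => exact ⟨y, rfl, hy, by simpa using hval⟩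
  | cons x v ih =>
    have hx : x.1 < k := hv x (by simp)
    have hv' : IsValid k v := fun y hy => hv y (by simp [hy])
    rw [List.length_cons] at hn
    obtain ⟨out, h1, h2, h3⟩ := ih hv' (by omega)
    rw [List.foldr_cons, h1, codeVal_cons, mulLetter]
    obtain ⟨i, b⟩ := x
    cases b with
    | true =>
      refine ⟨i :: out, rfl, ?_, by simp [h3, mul_assoc]⟩
      rintro a ha
      rcases List.mem_cons.1 ha with rfl | ha
      · exact hx
      · exact h2 a ha
    | false =>
      rcases hc.leftDiv_spec hG h2 hx with ⟨-, out', h4, h5, h6⟩ | ⟨h4, -⟩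
      · refine ⟨out', by simpa using h4, h5, ?_⟩
        rw [h3] at h6
        simpa [mul_assoc] using eq_inv_mul_of_mul_eq h6
      · refine absurd ?_ h4
        refine (IsGarsideGroup.mem_simples_iff.1 (hc.letterVal_mem hx)).2.trans ?_
        have h7 := (hG.mul_zpow_le_iff n).2 (hc.neg_length_le_codeVal hG hv')
        rw [← zpow_add, ← h3] at h7
        refine GroupLeL.trans ?_ h7
        simpa using IsGarsideGroup.zpow_le_zpow (Δ := Δ) (a := 1) (b := -v.length + n) (by omega)

theorem foldr_delta_spec (n : ℕ) {y : List ℕ} (hy : ∀ a ∈ y, a < k) :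
    (GroupLeL P ((Δ : G) ^ (n : ℤ)) (posVal s y) ∧
      ∃ out, (List.replicate n (c.2.1, false)).foldr (mulLetter c.2.2) (some y) = some out ∧
        (∀ a ∈ out, a < k) ∧ (Δ : G) ^ (n : ℤ) * posVal s out = posVal s y) ∨
    (¬ GroupLeL P ((Δ : G) ^ (n : ℤ)) (posVal s y) ∧
      (List.replicate n (c.2.1, false)).foldr (mulLetter c.2.2) (some y) = none) := by
  induction n with
  | zero =>
    refine Or.inl ⟨?_, y, rfl, hy, by simp⟩
    rw [Nat.cast_zero, zpow_zero, one_groupLeL_iff]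
    refine P.list_prod_mem fun z hz => ?_
    obtain ⟨x, hx, rfl⟩ := List.mem_map.1 hz
    exact (IsGarsideGroup.mem_simples_iff.1 (hc.letterVal_mem (hy x hx))).1
  | succ n ih =>
    rw [List.replicate_succ, List.foldr_cons]
    rcases ih with ⟨h1, out, h2, h3, h4⟩ | ⟨h1, h2⟩
    · have h5 : GroupLeL P ((Δ : G) ^ ((n + 1 : ℕ) : ℤ)) (posVal s y) ↔
          GroupLeL P (letterVal s c.2.1) (posVal s out) := by
        rw [← h4, Nat.cast_succ, zpow_add, groupLeL_mul_left_iff, zpow_one, hc.letterVal_delta]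
      rw [h5, h2, mulLetter]
      rcases hc.leftDiv_spec hG h3 hc.delta_lt with ⟨h6, out', h7, h8, h9⟩ | ⟨h6, h7⟩
      · refine Or.inl ⟨h6, out', by simpa using h7, h8, ?_⟩
        rw [hc.letterVal_delta] at h9
        rw [← h4, ← h9, Nat.cast_succ, zpow_add, zpow_one, mul_assoc]
      · exact Or.inr ⟨h6, by simpa using h7⟩
    · refine Or.inr ⟨fun h => h1 ((IsGarsideGroup.zpow_le_zpow (by omega)).trans h), ?_⟩
      rw [h2]
      rfl

/-- For `n` the length of `v`, the word for `vΔⁿ` can always be made positive. Dividing it `n` times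
by `Δ` succeeds exactly if `Δⁿ ≤ vΔⁿ`, which is equivalent to positivity of `v`. -/
theorem isPosWord_iff {v : WordCode} (hv : IsValid k v) : IsPosWord c v ↔ codeVal s v ∈ P := by
  have hy : ∀ a ∈ List.replicate v.length c.2.1, a < k := by
    intro a ha
    rw [List.eq_of_mem_replicate ha]
    exact hc.delta_lt
  obtain ⟨out, h1, h2, h3⟩ := hc.foldr_mulLetter_spec hG hv hy le_rfl
    (by simp [posVal, hc.letterVal_delta])
  have h4 : GroupLeL P ((Δ : G) ^ (v.length : ℤ)) (posVal s out) ↔ codeVal s v ∈ P := by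
    rw [h3, ← hG.mul_zpow_le_iff (-v.length), mul_assoc, ← zpow_add, add_neg_cancel, zpow_zero,
      mul_one, one_groupLeL_iff]
  rw [IsPosWord, List.map_const', List.map_const', List.foldr_append, h1, ← h4]
  rcases hc.foldr_delta_spec hG v.length h2 with ⟨h5, out', h6, -⟩ | ⟨h5, h6⟩
  · rw [h6]
    exact iff_of_true (by simp) h5
  · rw [h6]
    exact iff_of_false (by simp) h5

theorem wordEq_iff {v w : WordCode} (hv : IsValid k v) (hw : IsValid k w) :
    WordEq c v w ↔ codeVal s v = codeVal s w := by
  rw [WordEq, hc.isPosWord_iff hG (hv.wordInv.append hw), hc.isPosWord_iff hG (hw.wordInv.append hv)]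
  simp only [codeVal_append, codeVal_wordInv, ← groupLeL_iff]
  exact ⟨fun h => hG.antisymm h.1 h.2, fun h => by simp [h, GroupLeL.refl]⟩

omit hG in
theorem isValid_deltaWord (n : ℕ) (b : Bool) : IsValid k (deltaWord c n b) := by
  intro x hx
  obtain ⟨y, -, rfl⟩ := List.mem_map.1 hx
  exact hc.delta_lt

omit hG in
theorem codeVal_deltaWord (n : ℕ) (b : Bool) :
    codeVal s (deltaWord c n b) = (Δ : G) ^ (if b then (n : ℤ) else -n) := by
  cases b <;> simp [codeVal, deltaWord, hc.letterVal_delta]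

theorem wordInRange_iff {m : ℕ} {x : WordCode} (hx : IsValid k x) :
    WordInRange c m x ↔ InRange Δ m (codeVal s x) := by
  have hd := hc.isValid_deltaWord m true
  rw [WordInRange, hc.isPosWord_iff hG (hd.append hx), hc.isPosWord_iff hG (hx.wordInv.append hd),
    InRange, groupLeL_iff, groupLeL_iff]
  simp [hc.codeVal_deltaWord]

theorem isPosWord_shift_iff {m r : ℕ} {x : WordCode} (hx : IsValid k x) :
    IsPosWord c (deltaWord c r false ++ deltaWord c m true ++ x) ↔
      GroupLeL P ((Δ : G) ^ ((r : ℤ) - m)) (codeVal s x) := by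
  rw [hc.isPosWord_iff hG (((hc.isValid_deltaWord r false).append
    (hc.isValid_deltaWord m true)).append hx), groupLeL_iff]
  have h1 : codeVal s (deltaWord c r false ++ deltaWord c m true ++ x) =
      ((Δ : G) ^ ((r : ℤ) - m))⁻¹ * codeVal s x := by
    rw [codeVal_append, codeVal_append, hc.codeVal_deltaWord, hc.codeVal_deltaWord, ← zpow_add,
      ← zpow_neg]
    congr 2
    simp only [Bool.false_eq_true, if_false, if_true]
    ring
  rw [h1]

/-- The conjugating elements that a certificate lists for a word. -/
def _root_.Garside.certSet (s : Fin k → G) (K : CertCode) (x : WordCode) : Set G :=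
  {a | ∃ p ∈ K.2, p.1 = x ∧ codeVal s p.2 = a}

omit hG in
theorem isValid_of_isCert {g h : WordCode} {K : CertCode} (hK : IsCert (c, g, h) K)
    {p : WordCode × WordCode} (hp : p ∈ K.2) : IsValid k p.2 := fun a ha => by
  have := mem_letters_iff.1 ((hK.2.2 p hp).2.1 a ha)
  rwa [hc.card_eq] at this

theorem isConjList_certSet {g h : WordCode} (hh : IsValid k h) {K : CertCode}
    (hK : IsCert (c, g, h) K) {x : WordCode} (hx : x ∈ testWords c h) :
    IsConjList Δ K.1 (codeVal s x) (certSet s K x) := by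
  have hxv := hh.of_mem_testWords hx
  refine ⟨⟨_, hK.2.1 x hx, rfl, by simp⟩, ?_, ?_⟩
  · rintro _ ⟨p, hp, rfl, rfl⟩
    have := (hK.2.2 p hp).2.2.1
    rw [hc.wordInRange_iff hG ((hc.isValid_of_isCert hK hp).wordConj hxv)] at this
    simpa using this
  · rintro _ ⟨p, hp, rfl, rfl⟩ a ha hr
    obtain ⟨e, he, rfl⟩ : ∃ e ∈ letters c, codeVal s [e] = a := by
      rcases ha with ha | ha
      · obtain ⟨i, hi, rfl⟩ := hc.exists_letterVal_eq ha
        exact ⟨(i, true), mem_letters_iff.2 (by rwa [hc.card_eq]), by simp [codeVal]⟩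
      · obtain ⟨i, hi, h1⟩ := hc.exists_letterVal_eq ha
        exact ⟨(i, false), mem_letters_iff.2 (by rwa [hc.card_eq]), by simp [codeVal, h1]⟩
    have hev : IsValid k (p.2 ++ [e]) := (hc.isValid_of_isCert hK hp).append (by
      intro y hy
      rw [List.mem_singleton.1 hy, ← hc.card_eq]
      exact mem_letters_iff.1 he)
    obtain ⟨q, hq, hqp, hqe⟩ := (hK.2.2 p hp).2.2.2 e he (by
      rw [hc.wordInRange_iff hG (hev.wordConj hxv)]
      simpa using hr)
    rw [hqp, hc.wordEq_iff hG ((hc.isValid_of_isCert hK hq).wordConj hxv) (hev.wordConj hxv)] at hqe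
    refine ⟨_, ⟨q, hq, hqp, rfl⟩, ?_⟩
    simpa using hqe

/-- Any valid certificate decides correctly. Its list for `h` settles conjugacy with `g`, whose
value lies in the range, and the lists for `hⁿ` and `h⁻ⁿ` with `1 ≤ n ≤ k` settle maximality of the
infima. Conjugacy of the powers is automatic. -/
theorem certAccepts_iff {g h : WordCode} (hg : IsValid k g) (hh : IsValid k h) {K : CertCode}
    (hK : IsCert (c, g, h) K) : CertAccepts (c, g, h) K ↔
      codeVal s h ∈ stableSuperSummitSet P Δ (codeVal s g) := by
  have hNk := hG.natNorm_delta_lt_card hc.range_eq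
  have hh0 : h ∈ testWords c h := mem_testWords_iff.2 ⟨0, by rw [hc.card_eq]; omega, Or.inl rfl⟩
  have hgr : InRange Δ K.1 (codeVal s g) := (hc.wordInRange_iff hG hg).1 hK.1
  have h1 : (∃ p ∈ K.2, p.1 = h ∧ WordEq c (wordConj p.2 p.1) g) ↔
      IsConj (codeVal s g) (codeVal s h) := by
    rw [hG.isConj_iff_of_conjList (hc.isConjList_certSet hG hh hK hh0) hgr]
    constructor
    · rintro ⟨p, hp, rfl, hp'⟩
      rw [hc.wordEq_iff hG ((hc.isValid_of_isCert hK hp).wordConj hh) hg] at hp'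
      exact ⟨_, ⟨p, hp, rfl, rfl⟩, by simpa using hp'⟩
    · rintro ⟨_, ⟨p, hp, rfl, rfl⟩, hp'⟩
      refine ⟨p, hp, rfl, ?_⟩
      rw [hc.wordEq_iff hG ((hc.isValid_of_isCert hK hp).wordConj hh) hg]
      simpa using hp'
  have h2 : (∀ p ∈ K.2, ∀ r ∈ List.range (2 * K.1 + 1),
      IsPosWord c (deltaWord c r false ++ deltaWord c K.1 true ++ wordConj p.2 p.1) →
        IsPosWord c (deltaWord c r false ++ deltaWord c K.1 true ++ p.1)) ↔
      ∀ x ∈ testWords c h, InfMax Δ (codeVal s x) := by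
    have h3 : ∀ p ∈ K.2, IsValid k p.1 := fun p hp =>
      hh.of_mem_testWords (hK.2.2 p hp).1
    constructor
    · intro H x hx
      rw [hG.infMax_iff_of_conjList (hc.isConjList_certSet hG hh hK hx)]
      rintro _ ⟨p, hp, rfl, rfl⟩ r hr hle
      have h4 := H p hp r (List.mem_range.2 hr)
      rw [hc.isPosWord_shift_iff hG (h3 p hp),
        hc.isPosWord_shift_iff hG ((hc.isValid_of_isCert hK hp).wordConj (h3 p hp)),
        codeVal_wordConj] at h4
      exact h4 hle
    · intro H p hp r hr
      rw [hc.isPosWord_shift_iff hG (h3 p hp),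
        hc.isPosWord_shift_iff hG ((hc.isValid_of_isCert hK hp).wordConj (h3 p hp)),
        codeVal_wordConj]
      exact fun hle => H _ (hK.2.2 p hp).1 _ ⟨_, hle⟩
  rw [CertAccepts, h1, h2, hG.mem_stableSuperSummitSet_iff hNk.le]
  constructor
  · rintro ⟨hconj, H⟩ n hn hnk
    have hpow : codeVal s (wordPow h (n - 1)) = codeVal s h ^ n := by
      rw [codeVal_wordPow, Nat.sub_add_cancel hn]
    have hlt : n - 1 < c.1 := by rw [hc.card_eq]; omega
    refine hG.mem_superSummitSet_iff.2 ⟨?_, ?_, ?_⟩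
    · obtain ⟨u, hu⟩ := isConj_iff.1 hconj
      exact isConj_iff.2 ⟨u, by rw [← hu, conj_pow]⟩
    · rw [← hpow]
      exact H _ (mem_testWords_iff.2 ⟨n - 1, hlt, Or.inl rfl⟩)
    · rw [← hpow, ← codeVal_wordInv]
      exact H _ (mem_testWords_iff.2 ⟨n - 1, hlt, Or.inr rfl⟩)
  · intro H
    refine ⟨?_, fun x hx => ?_⟩
    · have := (H 1 le_rfl (by omega)).1
      rwa [pow_one, pow_one] at this
    · obtain ⟨n, hn, hx⟩ := mem_testWords_iff.1 hx
      rw [hc.card_eq] at hn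
      have h5 := hG.mem_superSummitSet_iff.1 (H (n + 1) (by omega) (by omega))
      rcases hx with rfl | rfl
      · rw [codeVal_wordPow]
        exact h5.2.1
      · rw [codeVal_wordInv, codeVal_wordPow]
        exact h5.2.2

/-- This is what makes the search halt: for a range containing all the words involved, choose one
conjugating word for each of the finitely many conjugates in that range. -/
theorem exists_isCert {g h : WordCode} (hg : IsValid k g) (hh : IsValid k h) :
    ∃ K, IsCert (c, g, h) K := by
  classical
  have hrep : ∀ a : G, ∃ v, IsValid k v ∧ codeVal s v = a := fun a => by
    obtain ⟨v, hv⟩ := hc.exists_wordValue_eq hG a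
    exact ⟨wordCode v, isValid_wordCode v, by rw [codeVal_wordCode, hv]⟩
  -- a common range for all elements
  have hrange : ∃ m : ℕ, ∀ x ∈ g :: testWords c h, InRange Δ m (codeVal s x) := by
    generalize g :: testWords c h = l
    induction l with
    | nil => exact ⟨0, by simp⟩
    | cons x l ih =>
      obtain ⟨m, hm⟩ := ih
      obtain ⟨n, hn1, hn2⟩ := hG.exists_bounds (codeVal s x)
      have hmono : ∀ {a b : ℕ} {y : G}, a ≤ b → InRange Δ a y → InRange Δ b y :=
        fun hab hy => ⟨(IsGarsideGroup.zpow_le_zpow (by omega)).trans hy.1,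
          hy.2.trans (IsGarsideGroup.zpow_le_zpow (by omega))⟩
      refine ⟨max n m, fun y hy => ?_⟩
      rcases List.mem_cons.1 hy with rfl | hy
      · exact hmono (le_max_left _ _) ⟨hn1, hn2⟩
      · exact hmono (le_max_right _ _) (hm y hy)
  obtain ⟨m, hm⟩ := hrange
  -- for every element a finite list of conjugating words
  have hconj : ∀ x : WordCode, ∃ U : List WordCode, (∀ u ∈ U, IsValid k u ∧
      InRange Δ m ((codeVal s u)⁻¹ * codeVal s x * codeVal s u)) ∧
      ∀ a : G, InRange Δ m (a⁻¹ * codeVal s x * a) →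
        ∃ u ∈ U, (codeVal s u)⁻¹ * codeVal s x * codeVal s u = a⁻¹ * codeVal s x * a := by
    intro x
    have hfin : {y : G | InRange Δ m y}.Finite := hG.finite_inRange
      (by rw [← hc.range_eq]; exact Set.finite_range s) m
    have hfin' := hfin.subset
      (t := {y | InRange Δ m y ∧ ∃ a : G, a⁻¹ * codeVal s x * a = y}) fun y hy => hy.1
    have hch : ∀ y : G, ∃ u, IsValid k u ∧ ((∃ a : G, a⁻¹ * codeVal s x * a = y) →
        (codeVal s u)⁻¹ * codeVal s x * codeVal s u = y) := by
      intro y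
      by_cases hy : ∃ a : G, a⁻¹ * codeVal s x * a = y
      · obtain ⟨a, ha⟩ := hy
        obtain ⟨u, hu, rfl⟩ := hrep a
        exact ⟨u, hu, fun _ => ha⟩
      · exact ⟨[], by simp [IsValid], fun h => absurd h hy⟩
    choose f hf hf' using hch
    refine ⟨hfin'.toFinset.toList.map f, ?_, ?_⟩
    · intro u hu
      obtain ⟨y, hy, rfl⟩ := List.mem_map.1 hu
      rw [Finset.mem_toList, Set.Finite.mem_toFinset] at hy
      refine ⟨hf y, ?_⟩
      rw [hf' y hy.2]
      exact hy.1
    · intro a ha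
      refine ⟨f (a⁻¹ * codeVal s x * a), List.mem_map.2 ⟨_, ?_, rfl⟩, hf' _ ⟨a, rfl⟩⟩
      rw [Finset.mem_toList, Set.Finite.mem_toFinset]
      exact ⟨ha, a, rfl⟩
  choose U hU1 hU2 using hconj
  have hmem : ∀ p : WordCode × WordCode,
      p ∈ ((testWords c h).flatMap fun x => (([] : WordCode) :: U x).map fun u => (x, u)) ↔
        p.1 ∈ testWords c h ∧ (p.2 = [] ∨ p.2 ∈ U p.1) := by
    rintro ⟨x, u⟩
    simp only [List.mem_flatMap, List.mem_map, List.mem_cons, Prod.mk.injEq]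
    constructor
    · rintro ⟨x, hx, u, hu, rfl, rfl⟩
      exact ⟨hx, hu⟩
    · rintro ⟨hx, hu⟩
      exact ⟨x, hx, u, hu, rfl, rfl⟩
  -- The empty word is added to each list because a certificate must contain every tested word
  -- paired with it.
  refine ⟨(m, (testWords c h).flatMap fun x => (([] : WordCode) :: U x).map fun u => (x, u)),
    (hc.wordInRange_iff hG hg).2 (hm g (by simp)), fun x hx => (hmem _).2 ⟨hx, Or.inl rfl⟩, ?_⟩
  rintro ⟨x, u⟩ hp
  obtain ⟨hx, hu⟩ := (hmem _).1 hp
  have hxv : IsValid k x := hh.of_mem_testWords hx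
  have huv : IsValid k u ∧ InRange Δ m ((codeVal s u)⁻¹ * codeVal s x * codeVal s u) := by
    rcases hu with hu | hu
    · have hu : u = [] := hu
      subst hu
      exact ⟨by simp [IsValid], by simpa using hm x (by simp [hx])⟩
    · exact hU1 x u hu
  refine ⟨hx, fun a ha => mem_letters_iff.2 (by rw [hc.card_eq]; exact huv.1 a ha), ?_, ?_⟩
  · rw [hc.wordInRange_iff hG (huv.1.wordConj hxv), codeVal_wordConj]
    exact huv.2
  · intro a ha hr
    have hav : IsValid k (u ++ [a]) := huv.1.append (by
      intro y hy
      rw [List.mem_singleton.1 hy, ← hc.card_eq]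
      exact mem_letters_iff.1 ha)
    rw [hc.wordInRange_iff hG (hav.wordConj hxv), codeVal_wordConj] at hr
    obtain ⟨w, hw, hw'⟩ := hU2 x _ hr
    refine ⟨(x, w), (hmem _).2 ⟨hx, Or.inr hw⟩, rfl, ?_⟩
    rw [hc.wordEq_iff hG ((hU1 x w hw).1.wordConj hxv) (hav.wordConj hxv), codeVal_wordConj,
      codeVal_wordConj]
    exact hw'

theorem decideStable_spec {g h : WordCode} (hg : IsValid k g) (hh : IsValid k h) :
    ∃ b : Bool, b ∈ decideStable (c, g, h) ∧
      (b = true ↔ codeVal s h ∈ stableSuperSummitSet P Δ (codeVal s g)) := by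
  classical
  obtain ⟨K, hK⟩ := hc.exists_isCert hG hg hh
  have hdom : (decideStable (c, g, h)).Dom := by
    refine Nat.rfindOpt_dom.2 ⟨Encodable.encode K, ?_⟩
    simp [certAnswer, hK]
  refine ⟨_, Part.get_mem hdom, ?_⟩
  -- The certificate found need not be `K`, but validity alone guarantees its answer.
  obtain ⟨n, hn⟩ := Nat.rfindOpt_spec (Part.get_mem hdom)
  obtain ⟨K', -, hK'⟩ := Option.bind_eq_some_iff.1 hn
  rw [certAnswer] at hK'
  split at hK'
  · next hcert =>
    rw [← hc.certAccepts_iff hG hg hh hcert, ← Option.some.inj hK', decide_eq_true_iff]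
  · simp at hK'

end IsCode

end Correctness

end Garside

theorem corollary6p2 :
    (∃ f : Garside.GroupCode × Garside.WordCode × Garside.WordCode →. Bool, Partrec f ∧
      ∀ (G : Type u) [Group G] (P : Submonoid G) (Δ : P), Garside.IsGarsideGroup P Δ →
        ∀ (k : ℕ) (s : Fin k → G) (c : Garside.GroupCode), Garside.IsCode P Δ s c →
          ∀ (g h : G) (v w : List (Fin k × Bool)),
            Garside.wordValue s v = g → Garside.wordValue s w = h →
              ∃ b : Bool, b ∈ f (c, Garside.wordCode v, Garside.wordCode w) ∧
                (b = true ↔ h ∈ Garside.stableSuperSummitSet P Δ g)) ∧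
    (∀ (G : Type u) [Group G] (P : Submonoid G) (Δ : P), Garside.IsGarsideGroup P Δ →
      ∀ (N : ℕ), Garside.atomNorm Δ = (N : ℕ∞) →
        ∀ g h : G, h ∈ Garside.stableSuperSummitSet P Δ g ↔
          ∀ n : ℕ, 1 ≤ n → n ≤ N → h ^ n ∈ Garside.superSummitSet P Δ (g ^ n)) := by
  refine ⟨⟨Garside.decideStable, Garside.partrec_decideStable, ?_⟩, ?_⟩
  · rintro G _ P Δ hG k s c hc _ _ v w rfl rfl
    have := hc.decideStable_spec hG (Garside.isValid_wordCode v) (Garside.isValid_wordCode w)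
    rwa [Garside.codeVal_wordCode, Garside.codeVal_wordCode] at this
  · intro G _ P Δ hG N hN g h
    exact hG.mem_stableSuperSummitSet_iff (by simp [Garside.natNorm, hN])
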